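/- Let $n\ge 1$ and let $S=\mathbb R^n\ltimes\mathbb R$ be the group with product $(x,t)\cdot(x',t')=(x+e^tx',t+t')$, equipped with its right Haar measure $d\rho(x,t)=dx\,dt$; write $L^q=L^q(\rho)$, $0<q<\infty$. A Calderón–Zygmund set is a set $R=Q\times[t-r,t+r)$, where $t\in\mathbb R$, $r>0$ and $Q=\prod_{i=1}^n[2^km_i,2^k(m_i+1))$ ($k,m_i\in\mathbb Z$) is a dyadic cube whose side length $L=2^k$ satisfies $$e^2e^tr\le L<e^8e^tr\ \text{ if } r<1,\qquad e^te^{2r}\le L<e^te^{8r}\ \text{ if } r\ge1 .$$ Let $\mathcal R$ be the family of these sets, and put $N=\max\{3,2^n\}$. A dyadic grid is a sequence $\mathcal D=\{\mathcal D_j\}_{j\in\mathbb Z}$ of partitions of $S$ into sets of $\mathcal R$ such that (a) if $\ell\le k$, $R\in\mathcal D_\ell$ and $R'\in\mathcal D_k$, then $R\subset R'$ or $R\cap R'=\emptyset$; (b) for every $R\in\mathcal D_j$ there is a unique $R'\in\mathcal D_{j+1}$ with $R\subset R'$ and $\rho(R')\le N\rho(R)$; (c) every $R\in\mathcal D_j$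 is the disjoint union of $k$ sets $R_1,\dots,R_k\in\mathcal D_{j-1}$, where $k=2$ or $k=2^n$, with $\rho(R)/N\le\rho(R_i)\le\frac23\rho(R)$; (d) for every $x\in S$, if $R_j^x$ is the set of $\mathcal D_j$ that contains $x$, then $\rho(R_j^x)\to0$ as $j\to-\infty$ and $\rho(R_j^x)\to\infty$ as $j\to\infty$. For a locally integrable $f:S\to\mathbb C$ and $R\in\mathcal R$ let $f_R=\frac1{\rho(R)}\int_Rf\,d\rho$, and put $$\mathcal M_{\mathcal D}f(x)=\sup_{x\in R\in\bigcup_j\mathcal D_j}\frac1{\rho(R)}\int_R|f|\,d\rho,\qquad f^\sharp_{\mathcal D}(x)=\sup_{x\in R\in\bigcup_j\mathcal D_j}\frac1{\rho(R)}\int_R|f-f_R|\,d\rho,\qquad f^\sharp(x)=\sup_{x\in R\in\mathcal R}\frac1{\rho(R)}\int_R|f-f_R|\,d\rho .$$ Then dyadic grids exist, and for every $p\in(0,\infty)$ there is a constant $A_p>0$, depending only on $n$ and $p$, with the following two properties. (1) For every dyadic grid $\mathcal D$ and every locally integrable $f$ such that $f^\sharp_{\mathcal D}\in L^p$ and $\mathcal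 M_{\mathcal D}f\in L^{p_0}$ for some $p_0\in(0,p]$, one has $f\in L^p$, $$\|\mathcal M_{\mathcal D}f\|_{L^p}\le A_p\|f^\sharp_{\mathcal D}\|_{L^p}\qquad\text{and}\qquad\|f\|_{L^p}\le A_p\|f^\sharp\|_{L^p},$$ where the last right-hand side may be infinite. (2) For every locally integrable $f$ such that $f^\sharp\in L^p$ and $f\in L^{p_0}$ for some $p_0\in(0,p]$, one has $f\in L^p$ and $\|f\|_{L^p}\le A_p\|f^\sharp\|_{L^p}$. -/

import Mathlib

open MeasureTheory Filter Topology
open scoped ENNReal NNReal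

noncomputable section

namespace AxPlusB

/-- The underlying space `ℝⁿ × ℝ` of the `ax + b`-group `S = ℝⁿ ⋊ ℝ`, whose product is
`(x, t) · (x', t') = (x + eᵗ x', t + t')`. Only its (product) topology and its right Haar
measure enter below; no norm on `ℝⁿ` is used. -/
abbrev S (n : ℕ) : Type := (Fin n → ℝ) × ℝ

/-- The right Haar measure `dρ(x, t) = dx dt` of `S`, i.e. Lebesgue measure on `ℝⁿ × ℝ`. -/
abbrev rho (n : ℕ) : Measure (S n) := volume

/-- The dyadic cube `∏ᵢ [2ᵏ mᵢ, 2ᵏ (mᵢ + 1))` of `ℝⁿ`, of side length `2ᵏ`. -/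
def dyadicCube {n : ℕ} (k : ℤ) (m : Fin n → ℤ) : Set (Fin n → ℝ) :=
  {x | ∀ i, (2 : ℝ) ^ k * (m i : ℝ) ≤ x i ∧ x i < (2 : ℝ) ^ k * ((m i : ℝ) + 1)}

/-- The relation required between the side length `L`, the centre `t` and the radius `r`
of a Calderón–Zygmund set. -/
def Admissible (L t r : ℝ) : Prop :=
  (r < 1 → Real.exp 2 * Real.exp t * r ≤ L ∧ L < Real.exp 8 * Real.exp t * r) ∧
  (1 ≤ r → Real.exp t * Real.exp (2 * r) ≤ L ∧ L < Real.exp t * Real.exp (8 * r))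

/-- Calderón–Zygmund sets: `R = Q × [t - r, t + r)` with `Q` a dyadic cube. -/
def IsCZSet {n : ℕ} (R : Set (S n)) : Prop :=
  ∃ (k : ℤ) (m : Fin n → ℤ) (t r : ℝ), 0 < r ∧ Admissible ((2 : ℝ) ^ k) t r ∧
    R = dyadicCube k m ×ˢ Set.Ico (t - r) (t + r)

/-- The maximal ratio between the measures of a dyadic set and of one of its children. It is
`2ⁿ`, except for `n = 1`, where splitting an interval `[t - 5r, t + r)` into
`[t - 5r, t - r)` and `[t - r, t + r)` is allowed as well. -/
def ratio (n : ℕ) : ℝ≥0∞ := max 3 (2 ^ n)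

/-- A dyadic grid on `S`: a sequence of nested partitions of `S` into
Calderón–Zygmund sets. -/
structure IsDyadicGrid {n : ℕ} (D : ℤ → Set (Set (S n))) : Prop where
  isCZSet : ∀ j, ∀ R ∈ D j, IsCZSet R
  pairwiseDisjoint : ∀ j, (D j).PairwiseDisjoint id
  sUnion_eq : ∀ j, ⋃₀ D j = Set.univ
  nested : ∀ l k, l ≤ k → ∀ R ∈ D l, ∀ R' ∈ D k, R ⊆ R' ∨ R ∩ R' = ∅
  parent : ∀ j, ∀ R ∈ D j,
    ∃! R' : Set (S n), R' ∈ D (j + 1) ∧ R ⊆ R' ∧ rho n R' ≤ ratio n * rho n R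
  children : ∀ j, ∀ R ∈ D j, ∃ F : Finset (Set (S n)),
    (F.card = 2 ∨ F.card = 2 ^ n) ∧ (F : Set (Set (S n))) ⊆ D (j - 1) ∧
    (F : Set (Set (S n))).PairwiseDisjoint id ∧ R = ⋃₀ (F : Set (Set (S n))) ∧
    ∀ R' ∈ F, rho n R / ratio n ≤ rho n R' ∧ rho n R' ≤ 2 / 3 * rho n R
  tendsto_measure : ∀ (x : S n) (R : ℤ → Set (S n)), (∀ j, R j ∈ D j ∧ x ∈ R j) →
    Tendsto (fun j => rho n (R j)) atBot (𝓝 0) ∧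
    Tendsto (fun j => rho n (R j)) atTop (𝓝 ∞)

/-- The mean of `|f|` over `R`. -/
def meanAbs {n : ℕ} (f : S n → ℂ) (R : Set (S n)) : ℝ≥0∞ :=
  (rho n R)⁻¹ * ∫⁻ y in R, ‖f y‖ₑ ∂(rho n)

/-- The mean oscillation `ρ(R)⁻¹ ∫_R |f - f_R| dρ`, where `f_R` is the average of `f` on `R`. -/
def meanOsc {n : ℕ} (f : S n → ℂ) (R : Set (S n)) : ℝ≥0∞ :=
  meanAbs (fun y => f y - ⨍ z in R, f z ∂(rho n)) R

/-- The dyadic Hardy–Littlewood maximal function. -/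
def dyadicMaximal {n : ℕ} (D : ℤ → Set (Set (S n))) (f : S n → ℂ) (x : S n) : ℝ≥0∞ :=
  ⨆ (R : Set (S n)) (_ : (∃ j, R ∈ D j) ∧ x ∈ R), meanAbs f R

/-- The dyadic sharp maximal function. -/
def dyadicSharp {n : ℕ} (D : ℤ → Set (Set (S n))) (f : S n → ℂ) (x : S n) : ℝ≥0∞ :=
  ⨆ (R : Set (S n)) (_ : (∃ j, R ∈ D j) ∧ x ∈ R), meanOsc f R

/-- The sharp maximal function, over all Calderón–Zygmund sets. -/
def sharp {n : ℕ} (f : S n → ℂ) (x : S n) : ℝ≥0∞ :=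
  ⨆ (R : Set (S n)) (_ : IsCZSet R ∧ x ∈ R), meanOsc f R

end AxPlusB

end

/-! This is a Fefferman–Stein inequality, proved on one cell at a time, so that the `L^p` norm of
the maximal function need not be finite a priori. Fix a cell `R` of generation `J`, and let `M_R` be
the maximal function over generations at most `J`. The Calderón–Zygmund decomposition of `f - f_R`
gives a good-`λ` inequality on `R` between `M_R(f - f_R)` and the dyadic sharp function
(`good_lambda`). Since `ρ(R)` is finite, truncation justifies absorbing a term, for every `p > 0`,
and the integral over `R` of `M_R(f - f_R)^p` is bounded by that of the sharp function to the power
`p`.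

It remains to control `f_R`. Let `R_j` be the ancestors of a point, `U` their union, and `I` the
integral over `U` of the sharp function to the power `p`. Consecutive means differ by at most `N (I
/ ρ(R_{j+1}))^{1/p}`, and `ρ(R_j)` grows at least by the factor `3/2`, so the means converge to some
`c` with error at most a constant times `(I / ρ(R_j))^{1/p}` (`exists_tendsto_average`). If `c ≠ 0`,
then for large `j` every point of `R_j` has `|f| ≥ |c|/3` or, with `a` the mean over `R_j`, `|f - a|
≥ |c|/3`. The first set has finite measure because `f ∈ L^{p₀}`, the second has bounded measure by
the local estimate, and this contradicts `ρ(R_j) → ∞`. Hence `c = 0`, so `|a|^p ρ(R_j)` is bounded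
by a constant times `I`. Adding this to the local estimate, letting `R_j` exhaust `U` and summing
over the countably many disjoint `U` gives the global bound.

The passage from the maximal function to `f` is Lebesgue differentiation along the cells: their
eccentricity is unbounded on `S`, but bounded for the small cells around a fixed point.

A grid is obtained from one subdivision rule: halve the cubes if the result is still admissible,
otherwise halve the interval. The rule never leaves the Calderón–Zygmund sets
(`Admissible.half_radius`). It is applied to an increasing chain of tiles, each a child of the next,
whose intervals exhaust `ℝ`. Property (2) is the same estimate for this grid, since the dyadic sharp
function is at most the full one. -/

noncomputable section

namespace AxPlusB

/-! ### Measure and topology of Calderón–Zygmund sets -/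

variable {n : ℕ}

theorem dyadicCube_eq_pi (k : ℤ) (m : Fin n → ℤ) :
    dyadicCube k m = Set.univ.pi fun i =>
      Set.Ico ((2 : ℝ) ^ k * (m i : ℝ)) ((2 : ℝ) ^ k * ((m i : ℝ) + 1)) := by
  ext x; simp [dyadicCube]

theorem volume_cube_prod_Ico (k : ℤ) (m : Fin n → ℤ) (a b : ℝ) :
    rho n (dyadicCube k m ×ˢ Set.Ico a b) =
      ENNReal.ofReal ((2 : ℝ) ^ k) ^ n * ENNReal.ofReal (b - a) := by
  rw [rho, Measure.volume_eq_prod, Measure.prod_prod, dyadicCube_eq_pi, Real.volume_pi_Ico,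
    Real.volume_Ico]
  congr 1
  simp [mul_add]

theorem measurableSet_dyadicCube (k : ℤ) (m : Fin n → ℤ) : MeasurableSet (dyadicCube k m) := by
  rw [dyadicCube_eq_pi]
  exact MeasurableSet.univ_pi fun i => measurableSet_Ico

theorem IsCZSet.measurableSet {R : Set (S n)} (h : IsCZSet R) : MeasurableSet R := by
  obtain ⟨k, m, t, r, -, -, rfl⟩ := h
  exact (measurableSet_dyadicCube k m).prod measurableSet_Ico

theorem IsCZSet.measure_pos {R : Set (S n)} (h : IsCZSet R) : 0 < rho n R := by
  obtain ⟨k, m, t, r, hr, -, rfl⟩ := h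
  rw [volume_cube_prod_Ico]
  refine ENNReal.mul_pos (pow_ne_zero _ ?_) ?_
  · simpa using zpow_pos (two_pos : (0 : ℝ) < 2) k
  · simpa using hr

theorem IsCZSet.measure_ne_top {R : Set (S n)} (h : IsCZSet R) : rho n R ≠ ∞ := by
  obtain ⟨k, m, t, r, hr, -, rfl⟩ := h
  rw [volume_cube_prod_Ico]
  exact ENNReal.mul_ne_top (ENNReal.pow_ne_top ENNReal.ofReal_ne_top) ENNReal.ofReal_ne_top

theorem IsCZSet.integrableOn {R : Set (S n)} (h : IsCZSet R) {f : S n → ℂ}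
    (hf : LocallyIntegrable f (rho n)) : IntegrableOn f R (rho n) := by
  obtain ⟨k, m, t, r, hr, -, rfl⟩ := h
  refine (hf.integrableOn_isCompact ((isCompact_univ_pi fun i : Fin n =>
    isCompact_Icc (a := (2 : ℝ) ^ k * (m i : ℝ)) (b := (2 : ℝ) ^ k * ((m i : ℝ) + 1))).prod
    (isCompact_Icc (a := t - r) (b := t + r)))).mono_set ?_
  rw [dyadicCube_eq_pi]
  exact Set.prod_mono (Set.pi_mono fun i _ => Set.Ico_subset_Icc_self) Set.Ico_subset_Icc_self

/-- This makes every generation of a grid countable, as `S` is separable, and it is a requirement on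
the members of a Vitali family. -/
theorem IsCZSet.nonempty_interior {R : Set (S n)} (h : IsCZSet R) : (interior R).Nonempty := by
  obtain ⟨k, m, t, r, hr, -, rfl⟩ := h
  rw [interior_prod_eq, dyadicCube_eq_pi, interior_pi_set Set.finite_univ, interior_Ico]
  refine Set.Nonempty.prod (Set.univ_pi_nonempty_iff.2 fun i => ?_) ?_
  · rw [interior_Ico, Set.nonempty_Ioo]
    have := zpow_pos (two_pos : (0 : ℝ) < 2) k
    nlinarith
  · rw [Set.nonempty_Ioo]; linarith

/-! ### Cells of a dyadic grid -/

theorem ratio_ne_top : ratio n ≠ ∞ := by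
  simp [ratio]

theorem IsDyadicGrid.exists_mem {D : ℤ → Set (Set (S n))} (hD : IsDyadicGrid D) (j : ℤ) (x : S n) :
    ∃ R ∈ D j, x ∈ R := by
  have : x ∈ ⋃₀ D j := by rw [hD.sUnion_eq]; trivial
  simpa using this

/-- The set of generation `j` of a dyadic grid that contains `x`. -/
def IsDyadicGrid.cell {D : ℤ → Set (Set (S n))} (hD : IsDyadicGrid D) (j : ℤ) (x : S n) :
    Set (S n) := (hD.exists_mem j x).choose

namespace IsDyadicGrid

variable {D : ℤ → Set (Set (S n))} (hD : IsDyadicGrid D)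
include hD

theorem cell_mem (j : ℤ) (x : S n) : hD.cell j x ∈ D j := (hD.exists_mem j x).choose_spec.1

theorem mem_cell (j : ℤ) (x : S n) : x ∈ hD.cell j x := (hD.exists_mem j x).choose_spec.2

theorem isCZSet_cell (j : ℤ) (x : S n) : IsCZSet (hD.cell j x) := hD.isCZSet j _ (hD.cell_mem j x)

theorem eq_cell {j : ℤ} {x : S n} {R : Set (S n)} (hR : R ∈ D j) (hx : x ∈ R) :
    R = hD.cell j x := by
  by_contra hne
  exact Set.disjoint_left.1 (hD.pairwiseDisjoint j hR (hD.cell_mem j x) hne) hx (hD.mem_cell j x)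

theorem cell_eq {j : ℤ} {x y : S n} (hy : y ∈ hD.cell j x) : hD.cell j y = hD.cell j x :=
  (hD.eq_cell (hD.cell_mem j x) hy).symm

theorem cell_mono {i j : ℤ} (hij : i ≤ j) (x : S n) : hD.cell i x ⊆ hD.cell j x := by
  refine (hD.nested i j hij _ (hD.cell_mem i x) _ (hD.cell_mem j x)).resolve_right fun h => ?_
  have : x ∈ hD.cell i x ∩ hD.cell j x := ⟨hD.mem_cell i x, hD.mem_cell j x⟩
  simp [h] at this

theorem measure_cell_succ_le (j : ℤ) (x : S n) :
    rho n (hD.cell (j + 1) x) ≤ ratio n * rho n (hD.cell j x) := by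
  obtain ⟨R', ⟨h1, h2, h3⟩, -⟩ := hD.parent j _ (hD.cell_mem j x)
  rwa [← hD.eq_cell h1 (h2 (hD.mem_cell j x))]

theorem measure_cell_le_succ (j : ℤ) (x : S n) :
    rho n (hD.cell j x) ≤ 2 / 3 * rho n (hD.cell (j + 1) x) := by
  obtain ⟨F, -, hF, -, hU, h⟩ := hD.children (j + 1) _ (hD.cell_mem (j + 1) x)
  have hx := hD.mem_cell (j + 1) x
  rw [hU] at hx
  obtain ⟨R, hR, hxR⟩ := hx
  have hR' : R ∈ D j := by simpa using hF hR
  rw [← hD.eq_cell hR' hxR]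
  exact (h R hR).2

theorem countable (j : ℤ) : (D j).Countable := by
  exact Set.PairwiseDisjoint.countable_of_nonempty_interior (s := id) (hD.pairwiseDisjoint j)
    fun R hR => (hD.isCZSet j R hR).nonempty_interior

theorem measurableSet_cell (j : ℤ) (x : S n) : MeasurableSet (hD.cell j x) :=
  (hD.isCZSet_cell j x).measurableSet

theorem measure_cell_ne_zero (j : ℤ) (x : S n) : rho n (hD.cell j x) ≠ 0 :=
  (hD.isCZSet_cell j x).measure_pos.ne'

theorem measure_cell_ne_top (j : ℤ) (x : S n) : rho n (hD.cell j x) ≠ ∞ :=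
  (hD.isCZSet_cell j x).measure_ne_top

/-- A function that depends only on the cell of generation `j` is measurable. -/
theorem measurable_comp_cell (j : ℤ) (F : Set (S n) → ℝ≥0∞) :
    Measurable fun x => F (hD.cell j x) := by
  intro s _
  have : (fun x => F (hD.cell j x)) ⁻¹' s = ⋃ R ∈ {R ∈ D j | F R ∈ s}, R := by
    ext x
    simp only [Set.mem_preimage, Set.mem_iUnion, Set.mem_ofPred_eq, exists_prop]
    refine ⟨fun h => ⟨_, ⟨hD.cell_mem j x, h⟩, hD.mem_cell j x⟩, ?_⟩
    rintro ⟨R, ⟨hR, hs⟩, hx⟩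
    rwa [← hD.eq_cell hR hx]
  rw [this]
  exact MeasurableSet.biUnion ((hD.countable j).mono fun R h => h.1)
    fun R hR => (hD.isCZSet j R hR.1).measurableSet

theorem iSup_eq_iSup_cell (F : Set (S n) → ℝ≥0∞) (x : S n) :
    (⨆ (R : Set (S n)) (_ : (∃ j, R ∈ D j) ∧ x ∈ R), F R) = ⨆ j, F (hD.cell j x) := by
  apply le_antisymm
  · refine iSup₂_le fun R hR => ?_
    obtain ⟨⟨j, hj⟩, hx⟩ := hR
    rw [hD.eq_cell hj hx]
    exact le_iSup (fun j => F (hD.cell j x)) j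
  · exact iSup_le fun j => le_iSup₂_of_le (hD.cell j x) ⟨⟨j, hD.cell_mem j x⟩, hD.mem_cell j x⟩ le_rfl

theorem dyadicMaximal_eq (f : S n → ℂ) (x : S n) :
    dyadicMaximal D f x = ⨆ j, meanAbs f (hD.cell j x) := hD.iSup_eq_iSup_cell _ x

theorem dyadicSharp_eq (f : S n → ℂ) (x : S n) :
    dyadicSharp D f x = ⨆ j, meanOsc f (hD.cell j x) := hD.iSup_eq_iSup_cell _ x

theorem measurable_dyadicSharp (f : S n → ℂ) : Measurable (dyadicSharp D f) := by
  rw [funext (hD.dyadicSharp_eq f)]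
  exact Measurable.iSup fun j => hD.measurable_comp_cell j _

theorem dyadicSharp_le_sharp (f : S n → ℂ) (x : S n) : dyadicSharp D f x ≤ sharp f x :=
  iSup₂_le fun R hR => le_iSup₂_of_le R ⟨hR.1.elim fun j hj => hD.isCZSet j R hj, hR.2⟩ le_rfl

theorem meanOsc_le_dyadicSharp (f : S n → ℂ) {j : ℤ} {x y : S n} (hy : y ∈ hD.cell j x) :
    meanOsc f (hD.cell j x) ≤ dyadicSharp D f y := by
  rw [hD.dyadicSharp_eq, ← hD.cell_eq hy]
  exact le_iSup (fun j => meanOsc f (hD.cell j y)) j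

end IsDyadicGrid

/-! ### Means over sets of positive finite measure -/

theorem meanAbs_mul_measure {f : S n → ℂ} {R : Set (S n)} (h0 : rho n R ≠ 0) (h1 : rho n R ≠ ∞) :
    meanAbs f R * rho n R = ∫⁻ y in R, ‖f y‖ₑ ∂(rho n) := by
  rw [meanAbs, mul_comm, ← mul_assoc, ENNReal.mul_inv_cancel h0 h1, one_mul]

theorem meanAbs_le_mul {f : S n → ℂ} {R R' : Set (S n)} {C : ℝ≥0∞} (hC : C ≠ ∞) (hRR : R ⊆ R')
    (h0 : rho n R ≠ 0) (h1 : rho n R ≠ ∞) (h : rho n R' ≤ C * rho n R) :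
    meanAbs f R ≤ C * meanAbs f R' := by
  have h0' : rho n R' ≠ 0 := fun h => h0 (measure_mono_null hRR h)
  have h1' : rho n R' ≠ ∞ := ne_top_of_le_ne_top (ENNReal.mul_ne_top hC h1) h
  rw [meanAbs, meanAbs, ← mul_assoc]
  refine mul_le_mul' ?_ (lintegral_mono_set hRR)
  rw [← div_eq_mul_inv, ENNReal.le_div_iff_mul_le (.inl h0') (.inl h1'), mul_comm,
    ← div_eq_mul_inv]
  exact ENNReal.div_le_of_le_mul h

theorem meanAbs_const {c : ℂ} {R : Set (S n)} (h0 : rho n R ≠ 0) (h1 : rho n R ≠ ∞) :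
    meanAbs (fun _ => c) R = ‖c‖ₑ := by
  rw [meanAbs, setLIntegral_const, mul_comm, mul_assoc, ENNReal.mul_inv_cancel h0 h1, mul_one]

theorem meanAbs_le_sub_add (f : S n → ℂ) (c : ℂ) {R : Set (S n)} (h0 : rho n R ≠ 0)
    (h1 : rho n R ≠ ∞) : meanAbs f R ≤ meanAbs (fun y => f y - c) R + ‖c‖ₑ := by
  rw [← meanAbs_const (c := c) h0 h1, meanAbs, meanAbs, meanAbs, ← mul_add,
    ← lintegral_add_right _ measurable_const]
  gcongr with y
  simpa using enorm_add_le (f y - c) c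

theorem enorm_average_le (f : S n → ℂ) (R : Set (S n)) :
    ‖⨍ y in R, f y ∂(rho n)‖ₑ ≤ meanAbs f R := by
  rw [setAverage_eq, enorm_smul, meanAbs]
  gcongr
  · rw [Real.enorm_eq_ofReal (by positivity)]
    rcases eq_or_ne (rho n R) 0 with h | h
    · simp [h]
    rcases eq_or_ne (rho n R) ∞ with h' | h'
    · simp [Measure.real, h']
    rw [Measure.real, ENNReal.ofReal_inv_of_pos (ENNReal.toReal_pos h h'), ENNReal.ofReal_toReal h']
  · exact enorm_integral_le_lintegral_enorm _

theorem average_sub_const {f : S n → ℂ} {c : ℂ} {R : Set (S n)} (hf : IntegrableOn f R (rho n))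
    (h0 : rho n R ≠ 0) (h1 : rho n R ≠ ∞) :
    ⨍ y in R, (f y - c) ∂(rho n) = (⨍ y in R, f y ∂(rho n)) - c := by
  have hc : IntegrableOn (fun _ : S n => c) R (rho n) := integrableOn_const h1
  have : ⨍ _ in R, c ∂(rho n) = c := setAverage_const h0 h1 c
  conv_rhs => rw [← this]
  rw [setAverage_eq, setAverage_eq, setAverage_eq, integral_sub hf hc, smul_sub]

/-! ### Integration of a good-`λ` inequality -/

theorem lintegral_rpow_le_of_truncation {α : Type*} [MeasurableSpace α] {μ : Measure α}
    {F : α → ℝ≥0∞} (hF : Measurable F) {p : ℝ} (hp : 0 < p) {C : ℝ≥0∞}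
    (h : ∀ K : ℕ, ∫⁻ x, (min (F x) K) ^ p ∂μ ≤ C) : ∫⁻ x, F x ^ p ∂μ ≤ C := by
  have hsup : ∀ x, F x ^ p = ⨆ K : ℕ, (min (F x) K) ^ p := fun x => by
    have h1 : (⨆ K : ℕ, min (F x) (K : ℝ≥0∞)) = F x := by
      rw [← inf_iSup_eq, ENNReal.iSup_natCast, inf_top_eq]
    have h2 := (ENNReal.orderIsoRpow p hp).map_iSup fun K : ℕ => min (F x) (K : ℝ≥0∞)
    rw [h1] at h2
    exact h2
  simp_rw [hsup]
  rw [lintegral_iSup (fun K => (hF.min measurable_const).pow_const p)]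
  · exact iSup_le h
  · intro a b hab x
    exact ENNReal.rpow_le_rpow (min_le_min le_rfl (by exact_mod_cast hab)) hp.le

/-- Integrating the hypothesis against `p t^{p-1} dt` gives `b^{-p} X ≤ γ^{-p} Y + γ X`, where `X`
and `Y` are the integrals of the truncated `F^p` and `s^p`. As `γ b^p ≤ 1/2`, the last term is
absorbed after multiplication by `b^p`. -/
theorem lintegral_rpow_le_of_good_lambda {α : Type*} [MeasurableSpace α] {μ : Measure α}
    [IsFiniteMeasure μ] {F s : α → ℝ≥0∞} (hF : Measurable F) (hs : Measurable s) {p b γ : ℝ}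
    (hp : 0 < p) (hb : 1 ≤ b) (hγ : 0 < γ) (hγ1 : γ ≤ 1) (hbγ : γ * b ^ p ≤ 1 / 2)
    (h : ∀ t : ℝ, 0 < t → μ {x | ENNReal.ofReal (b * t) < F x} ≤
      μ {x | ENNReal.ofReal (γ * t) < s x} + ENNReal.ofReal γ * μ {x | ENNReal.ofReal t < F x}) :
    ∫⁻ x, F x ^ p ∂μ ≤ ENNReal.ofReal (2 * b ^ p * (γ⁻¹) ^ p) * ∫⁻ x, s x ^ p ∂μ := by
  refine lintegral_rpow_le_of_truncation hF hp fun K => ?_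
  have hb0 : 0 < b := by linarith
  have hbp : 0 < b ^ p := Real.rpow_pos_of_pos hb0 p
  have hKtop : ∀ y : ℝ≥0∞, min y (K : ℝ≥0∞) ≠ ∞ := fun y =>
    ne_top_of_le_ne_top (ENNReal.natCast_ne_top K) (min_le_right _ _)
  set u : α → ℝ := fun x => (min (F x) K).toReal with hu
  set v : α → ℝ := fun x => (min (s x) K).toReal with hv
  have hum : Measurable u := (hF.min measurable_const).ennreal_toReal
  have hvm : Measurable v := (hs.min measurable_const).ennreal_toReal
  have hu0 : ∀ x, 0 ≤ u x := fun x => ENNReal.toReal_nonneg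
  have hv0 : ∀ x, 0 ≤ v x := fun x => ENNReal.toReal_nonneg
  have hlt : ∀ (y : ℝ≥0∞) (t : ℝ), 0 ≤ t →
      (t < (min y (K : ℝ≥0∞)).toReal ↔ ENNReal.ofReal t < y ∧ t < K) := fun y t ht => by
    rw [← ENNReal.ofReal_lt_iff_lt_toReal ht (hKtop y), lt_min_iff]
    refine and_congr_right fun _ => ?_
    rw [ENNReal.ofReal_lt_iff_lt_toReal ht (ENNReal.natCast_ne_top K), ENNReal.toReal_natCast]
  have hlevel : ∀ t : ℝ, 0 < t → μ {x | t < b⁻¹ * u x} ≤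
      μ {x | t < γ⁻¹ * v x} + ENNReal.ofReal γ * μ {x | t < u x} := fun t ht => by
    have e1 : {x | t < b⁻¹ * u x} = {x | b * t < u x} := by
      ext x; simp only [Set.mem_ofPred_eq]; rw [lt_inv_mul_iff₀ hb0]
    have e2 : {x | t < γ⁻¹ * v x} = {x | γ * t < v x} := by
      ext x; simp only [Set.mem_ofPred_eq]; rw [lt_inv_mul_iff₀ hγ]
    rw [e1, e2]
    have hbt : t ≤ b * t := le_mul_of_one_le_left ht.le hb
    have hγt : γ * t ≤ t := mul_le_of_le_one_left ht.le hγ1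
    -- Truncation preserves the good-`λ` inequality: if `b t ≥ K` the left side is empty, and
    -- otherwise `γ t ≤ t ≤ b t < K`, so the truncation changes none of the three level sets.
    rcases le_or_gt (K : ℝ) (b * t) with hK | hK
    · have : {x | b * t < u x} = ∅ := by
        ext x
        simp only [Set.mem_ofPred_eq, Set.mem_empty_iff_false, iff_false]
        rw [hu, hlt _ _ (by positivity)]
        exact fun h => absurd h.2 hK.not_gt
      simp [this]
    · have e3 : ∀ (G : α → ℝ≥0∞) (r : ℝ), 0 ≤ r → r < K →
          {x | r < (min (G x) (K : ℝ≥0∞)).toReal} = {x | ENNReal.ofReal r < G x} := by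
        intro G r hr hrK
        ext x
        simp only [Set.mem_ofPred_eq]
        rw [hlt _ _ hr]
        exact ⟨fun h => h.1, fun h => ⟨h, hrK⟩⟩
      rw [hu, hv, e3 F _ (by positivity) hK, e3 s _ (by positivity) (by linarith),
        e3 F _ ht.le (by linarith)]
      exact h t ht
  have anti : ∀ w : α → ℝ, Measurable fun t : ℝ => μ {x | t < w x} := fun w =>
    Antitone.measurable fun a c hac => measure_mono fun x (hx : c < w x) => hac.trans_lt hx
  set X : ℝ≥0∞ := ∫⁻ x, ENNReal.ofReal (u x ^ p) ∂μ with hX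
  set Y : ℝ≥0∞ := ∫⁻ x, ENNReal.ofReal (v x ^ p) ∂μ with hY
  have hscale : ∀ (w : α → ℝ) (a : ℝ), 0 ≤ a → (∀ x, 0 ≤ w x) → Measurable w →
      ∫⁻ x, ENNReal.ofReal ((a * w x) ^ p) ∂μ =
        ENNReal.ofReal (a ^ p) * ∫⁻ x, ENNReal.ofReal (w x ^ p) ∂μ := by
    intro w a ha hw hwm
    rw [← lintegral_const_mul _ (by fun_prop)]
    refine lintegral_congr fun x => ?_
    rw [Real.mul_rpow ha (hw x), ENNReal.ofReal_mul (by positivity)]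
  have key : ENNReal.ofReal ((b⁻¹) ^ p) * X ≤
      ENNReal.ofReal ((γ⁻¹) ^ p) * Y + ENNReal.ofReal γ * X := by
    rw [← hscale u _ (by positivity) hu0 hum, ← hscale v _ (by positivity) hv0 hvm,
      lintegral_rpow_eq_lintegral_meas_lt_mul μ
        (ae_of_all _ fun x => mul_nonneg (by positivity) (hu0 x)) (by fun_prop) hp,
      lintegral_rpow_eq_lintegral_meas_lt_mul μ
        (ae_of_all _ fun x => mul_nonneg (by positivity) (hv0 x)) (by fun_prop) hp, hX,
      lintegral_rpow_eq_lintegral_meas_lt_mul μ (ae_of_all _ hu0) (by fun_prop) hp,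
      mul_left_comm, ← mul_add]
    refine mul_le_mul' le_rfl ?_
    have hm : Measurable fun t : ℝ => μ {x | t < γ⁻¹ * v x} * ENNReal.ofReal (t ^ (p - 1)) :=
      (anti _).mul (by fun_prop)
    rw [← lintegral_const_mul' _ _ ENNReal.ofReal_ne_top, ← lintegral_add_left hm]
    refine setLIntegral_mono' measurableSet_Ioi fun t ht => ?_
    rw [← mul_assoc, ← add_mul]
    gcongr
    exact hlevel t ht
  -- Both the truncation and the finiteness of `μ` are needed here; without `X < ∞` half of `X`
  -- could not be subtracted.
  have hXtop : X ≠ ∞ := by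
    refine ne_top_of_le_ne_top (b := ENNReal.ofReal ((K : ℝ) ^ p) * μ Set.univ)
      (ENNReal.mul_ne_top ENNReal.ofReal_ne_top (measure_ne_top _ _)) ?_
    rw [← lintegral_const]
    refine lintegral_mono fun x => ENNReal.ofReal_le_ofReal ?_
    refine Real.rpow_le_rpow (hu0 x) ?_ hp.le
    simpa using ENNReal.toReal_mono (ENNReal.natCast_ne_top K) (min_le_right (F x) (K : ℝ≥0∞))
  have hmul : X ≤ ENNReal.ofReal (b ^ p * (γ⁻¹) ^ p) * Y + ENNReal.ofReal (1 / 2) * X := by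
    calc X = ENNReal.ofReal (b ^ p) * (ENNReal.ofReal ((b⁻¹) ^ p) * X) := by
          rw [← mul_assoc, ← ENNReal.ofReal_mul hbp.le, ← Real.mul_rpow hb0.le (by positivity),
            mul_inv_cancel₀ hb0.ne', Real.one_rpow, ENNReal.ofReal_one, one_mul]
      _ ≤ ENNReal.ofReal (b ^ p) * (ENNReal.ofReal ((γ⁻¹) ^ p) * Y + ENNReal.ofReal γ * X) := by
          gcongr
      _ = ENNReal.ofReal (b ^ p * (γ⁻¹) ^ p) * Y + ENNReal.ofReal (γ * b ^ p) * X := by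
          rw [mul_add, ← mul_assoc, ← mul_assoc, ← ENNReal.ofReal_mul hbp.le,
            ← ENNReal.ofReal_mul hbp.le, mul_comm γ]
      _ ≤ _ := by gcongr
  have hhalf : ENNReal.ofReal (1 / 2) * X ≤ ENNReal.ofReal (b ^ p * (γ⁻¹) ^ p) * Y := by
    have hsplit : X = ENNReal.ofReal (1 / 2) * X + ENNReal.ofReal (1 / 2) * X := by
      rw [← add_mul, ← ENNReal.ofReal_add (by norm_num) (by norm_num)]
      norm_num
    refine (ENNReal.add_le_add_iff_right
      (ENNReal.mul_ne_top (ENNReal.ofReal_ne_top (r := 1 / 2)) hXtop)).1 ?_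
    rw [← hsplit]; exact hmul
  have hconv : ∀ y : ℝ≥0∞, ENNReal.ofReal ((min y (K : ℝ≥0∞)).toReal ^ p) = min y (K : ℝ≥0∞) ^ p :=
    fun y => by
      rw [← ENNReal.ofReal_rpow_of_nonneg ENNReal.toReal_nonneg hp.le,
        ENNReal.ofReal_toReal (hKtop y)]
  calc ∫⁻ x, (min (F x) K) ^ p ∂μ = X := lintegral_congr fun x => (hconv _).symm
    _ = ENNReal.ofReal 2 * (ENNReal.ofReal (1 / 2) * X) := by
        rw [← mul_assoc, ← ENNReal.ofReal_mul (by norm_num)]; norm_num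
    _ ≤ ENNReal.ofReal 2 * (ENNReal.ofReal (b ^ p * (γ⁻¹) ^ p) * Y) := by gcongr
    _ = ENNReal.ofReal (2 * b ^ p * (γ⁻¹) ^ p) * Y := by
        rw [← mul_assoc, ← ENNReal.ofReal_mul (by norm_num), mul_assoc 2]
    _ ≤ _ := by
        refine mul_le_mul' le_rfl (lintegral_mono fun x => ?_)
        refine (hconv (s x)).trans_le ?_
        exact ENNReal.rpow_le_rpow (min_le_left _ _) hp.le

/-! ### Local maximal functions and the good-`λ` inequality -/

namespace IsDyadicGrid

variable {D : ℤ → Set (Set (S n))} (hD : IsDyadicGrid D)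

/-- The dyadic maximal function over the sets of generation at most `J`. -/
def localMaximal (J : ℤ) (g : S n → ℂ) (x : S n) : ℝ≥0∞ :=
  ⨆ (i : ℤ) (_ : i ≤ J), meanAbs g (hD.cell i x)

include hD

theorem measurable_localMaximal (J : ℤ) (g : S n → ℂ) : Measurable (hD.localMaximal J g) :=
  Measurable.iSup fun i => Measurable.iSup fun _ => hD.measurable_comp_cell i _

theorem lt_localMaximal_iff {J : ℤ} {g : S n → ℂ} {x : S n} {l : ℝ≥0∞} :
    l < hD.localMaximal J g x ↔ ∃ i ≤ J, l < meanAbs g (hD.cell i x) := by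
  simp [localMaximal, lt_iSup_iff]

theorem localMaximal_mono {i j : ℤ} (hij : i ≤ j) (g : S n → ℂ) (x : S n) :
    hD.localMaximal i g x ≤ hD.localMaximal j g x :=
  iSup₂_le fun k hk => le_iSup₂_of_le k (hk.trans hij) le_rfl

theorem localMaximal_le_sub_add (J : ℤ) (f : S n → ℂ) (c : ℂ) (x : S n) :
    hD.localMaximal J f x ≤ hD.localMaximal J (fun y => f y - c) x + ‖c‖ₑ := by
  refine iSup₂_le fun i hi => (meanAbs_le_sub_add f c (hD.measure_cell_ne_zero i x)
    (hD.measure_cell_ne_top i x)).trans ?_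
  gcongr
  exact le_iSup₂_of_le i hi le_rfl

/-- The level set of the local maximal function is the disjoint union of the maximal dyadic sets
on which the mean exceeds the level. -/
theorem exists_maximal_cells (g : S n → ℂ) (J : ℤ) (x₀ : S n) (l : ℝ≥0∞) :
    ∃ 𝒜 : Set (Set (S n)), 𝒜.Countable ∧ 𝒜.PairwiseDisjoint id ∧
      ⋃₀ 𝒜 = hD.cell J x₀ ∩ {x | l < hD.localMaximal J g x} ∧
      ∀ A ∈ 𝒜, ∃ i ≤ J, ∃ x, A = hD.cell i x ∧ A ⊆ hD.cell J x₀ ∧ l < meanAbs g A ∧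
        ∀ k, i < k → k ≤ J → meanAbs g (hD.cell k x) ≤ l := by
  refine ⟨{A | ∃ i ≤ J, ∃ x, A = hD.cell i x ∧ A ⊆ hD.cell J x₀ ∧ l < meanAbs g A ∧
        ∀ k, i < k → k ≤ J → meanAbs g (hD.cell k x) ≤ l}, ?_, ?_, ?_, fun A hA => hA⟩
  · refine (Set.countable_iUnion hD.countable).mono ?_
    rintro A ⟨i, -, x, rfl, -⟩
    exact Set.mem_iUnion.2 ⟨i, hD.cell_mem i x⟩
  · rintro A ⟨i, hi, x, rfl, -, hl, hmax⟩ B ⟨k, hk, y, rfl, -, hl', hmax'⟩ hne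
    refine Set.disjoint_left.2 fun z hz hz' => hne ?_
    simp only [id] at hz hz'
    rw [← hD.cell_eq hz] at hl ⊢
    rw [← hD.cell_eq hz'] at hl' ⊢
    rcases lt_trichotomy i k with h | h | h
    · have := hmax k h hk
      rw [← hD.cell_eq (hD.cell_mono h.le x hz)] at this
      exact absurd hl' this.not_gt
    · rw [h]
    · have := hmax' i h hi
      rw [← hD.cell_eq (hD.cell_mono h.le y hz')] at this
      exact absurd hl this.not_gt
  · ext z
    constructor
    · rintro ⟨A, ⟨i, hi, x, rfl, hsub, hl, -⟩, hz⟩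
      refine ⟨hsub hz, hD.lt_localMaximal_iff.2 ⟨i, hi, ?_⟩⟩
      rwa [hD.cell_eq hz]
    · rintro ⟨hz, hz'⟩
      -- The cap `J` on the generations provides a largest cell above the level without any decay of
      -- the means.
      obtain ⟨i, ⟨hi, hl⟩, hmax⟩ := Int.exists_greatest_of_bdd
        (P := fun i => i ≤ J ∧ l < meanAbs g (hD.cell i z)) ⟨J, fun i hi => hi.1⟩
        (by obtain ⟨i, hi, hl⟩ := hD.lt_localMaximal_iff.1 hz'; exact ⟨i, hi, hl⟩)
      refine ⟨hD.cell i z, ⟨i, hi, z, rfl, ?_, hl, fun k hk hkJ => ?_⟩, hD.mem_cell i z⟩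
      · rw [← hD.cell_eq hz]; exact hD.cell_mono hi z
      · by_contra hcon
        exact absurd (hmax k ⟨hkJ, not_le.1 hcon⟩) hk.not_ge

/-- The weak type `(1, 1)` estimate for the local maximal function. -/
theorem mul_measure_lt_localMaximal_le (g : S n → ℂ) (J : ℤ) (x₀ : S n) (l : ℝ≥0∞) :
    l * rho n (hD.cell J x₀ ∩ {x | l < hD.localMaximal J g x}) ≤
      ∫⁻ y in hD.cell J x₀, ‖g y‖ₑ ∂(rho n) := by
  obtain ⟨𝒜, hc, hdisj, hU, hA⟩ := hD.exists_maximal_cells g J x₀ l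
  have hm : ∀ A ∈ 𝒜, MeasurableSet A := fun A h => by
    obtain ⟨i, -, x, rfl, -⟩ := hA A h
    exact hD.measurableSet_cell i x
  calc l * rho n (hD.cell J x₀ ∩ {x | l < hD.localMaximal J g x})
      = ∑' A : 𝒜, l * rho n (A : Set (S n)) := by
        rw [← hU, measure_sUnion hc hdisj hm, ENNReal.tsum_mul_left]
    _ ≤ ∑' A : 𝒜, ∫⁻ y in (A : Set (S n)), ‖g y‖ₑ ∂(rho n) := by
        refine ENNReal.tsum_le_tsum fun A => ?_
        obtain ⟨i, -, x, hx, -, hl, -⟩ := hA A A.2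
        rw [← meanAbs_mul_measure (by rw [hx]; exact hD.measure_cell_ne_zero i x)
          (by rw [hx]; exact hD.measure_cell_ne_top i x)]
        gcongr
    _ = ∫⁻ y in ⋃₀ 𝒜, ‖g y‖ₑ ∂(rho n) := by
        rw [Set.sUnion_eq_biUnion, lintegral_biUnion hc hm hdisj]
    _ ≤ _ := lintegral_mono_set (by rw [hU]; exact Set.inter_subset_left)

/-- The good-`λ` inequality on a maximal cell. -/
theorem measure_cell_inter_le {f : S n → ℂ} (hf : LocallyIntegrable f (rho n)) (c : ℂ) {i J : ℤ}
    (hi : i < J) {x : S n} {l γ : ℝ≥0∞} (hl0 : l ≠ 0) (hl : l ≠ ∞)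
    (hmax : ∀ k, i < k → k ≤ J → meanAbs (fun y => f y - c) (hD.cell k x) ≤ l) :
    rho n (hD.cell i x ∩ {y | (ratio n + 1) * l < hD.localMaximal J (fun y => f y - c) y}) ≤
      rho n (hD.cell i x ∩ {y | γ * l < dyadicSharp D f y}) + γ * rho n (hD.cell i x) := by
  -- If the sharp function exceeds `γ l` on the whole cell, the first term on the right suffices.
  -- Otherwise one good point bounds the oscillation over the cell by `γ l`, and the second term
  -- suffices.
  by_cases hs : ∃ y ∈ hD.cell i x, dyadicSharp D f y ≤ γ * l
  · refine le_add_left ?_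
    obtain ⟨y₀, hy₀, hsy₀⟩ := hs
    have h0 := hD.measure_cell_ne_zero i x
    have h1 := hD.measure_cell_ne_top i x
    set a : ℂ := ⨍ y in hD.cell i x, f y ∂(rho n) with ha
    have hac : ‖a - c‖ₑ ≤ ratio n * l := by
      rw [ha, ← average_sub_const ((hD.isCZSet_cell i x).integrableOn hf) h0 h1]
      refine (enorm_average_le _ _).trans ?_
      refine (meanAbs_le_mul ratio_ne_top (hD.cell_mono (by lia) x) h0 h1
        (hD.measure_cell_succ_le i x)).trans ?_
      gcongr
      exact hmax (i + 1) (by lia) (by lia)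
    -- Larger cells have mean at most `l`, so only subcells can exceed the level. Replacing `c` by
    -- the mean `a` of the cell costs at most `N l`, by comparison with the parent, which leaves `l`
    -- out of `(N + 1) l`.
    have hsub : hD.cell i x ∩
        {y | (ratio n + 1) * l < hD.localMaximal J (fun y => f y - c) y} ⊆
        hD.cell i x ∩ {y | l < hD.localMaximal i (fun y => f y - a) y} := by
      rintro y ⟨hy, hy'⟩
      refine ⟨hy, ?_⟩
      obtain ⟨k, hk, hlk⟩ := hD.lt_localMaximal_iff.1 hy'
      have hki : k ≤ i := by
        by_contra hcon
        have := hmax k (not_le.1 hcon) hk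
        rw [← hD.cell_eq (hD.cell_mono (not_le.1 hcon).le x hy)] at this
        refine absurd (this.trans ?_) hlk.not_ge
        exact le_mul_of_one_le_left' (le_add_left le_rfl)
      refine hD.lt_localMaximal_iff.2 ⟨k, hki, ?_⟩
      have h2 := meanAbs_le_sub_add (fun y => f y - c) (a - c) (hD.measure_cell_ne_zero k y)
        (hD.measure_cell_ne_top k y)
      simp only [sub_sub_sub_cancel_right] at h2
      have h3 := hlk.trans_le (h2.trans (add_le_add_right hac _))
      rw [add_mul, one_mul, add_comm] at h3
      exact (ENNReal.add_lt_add_iff_right (ENNReal.mul_ne_top ratio_ne_top hl)).1 h3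
    refine (measure_mono hsub).trans ?_
    have h4 := hD.mul_measure_lt_localMaximal_le (fun y => f y - a) i x l
    rw [← meanAbs_mul_measure h0 h1] at h4
    have h5 : l * rho n (hD.cell i x ∩ {y | l < hD.localMaximal i (fun y => f y - a) y}) ≤
        l * (γ * rho n (hD.cell i x)) := by
      refine h4.trans ?_
      rw [← mul_assoc, mul_comm l γ]
      gcongr
      exact (hD.meanOsc_le_dyadicSharp f hy₀).trans hsy₀
    exact (ENNReal.mul_le_mul_iff_right hl0 hl).1 h5
  · push Not at hs
    refine le_add_right (measure_mono fun y hy => ⟨hy.1, hs y hy.1⟩)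

/-- The inequality on one maximal cell is summed over the disjoint maximal cells. Subtracting the
mean over the top cell is what makes the top cell harmless. -/
theorem good_lambda {f : S n → ℂ} (hf : LocallyIntegrable f (rho n)) (J : ℤ) (x₀ : S n)
    {l γ : ℝ≥0∞} (hl0 : l ≠ 0) (hl : l ≠ ∞) (hγ : γ ≤ 1) {c : ℂ}
    (hc : c = ⨍ y in hD.cell J x₀, f y ∂(rho n)) :
    rho n (hD.cell J x₀ ∩ {y | (ratio n + 1) * l < hD.localMaximal J (fun y => f y - c) y}) ≤
      rho n (hD.cell J x₀ ∩ {y | γ * l < dyadicSharp D f y}) +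
        γ * rho n (hD.cell J x₀ ∩ {y | l < hD.localMaximal J (fun y => f y - c) y}) := by
  have hosc : meanOsc f (hD.cell J x₀) = meanAbs (fun y => f y - c) (hD.cell J x₀) := by
    rw [hc]; rfl
  -- If the oscillation over the top cell exceeds `l`, so does the sharp function at all its points.
  -- Otherwise the top cell is not selected, and every maximal cell has a parent of generation at
  -- most `J`.
  rcases lt_or_ge l (meanOsc f (hD.cell J x₀)) with hlt | hge
  · refine le_add_right (measure_mono fun y hy => ⟨hy.1, ?_⟩)
    calc γ * l ≤ 1 * l := by gcongr
      _ = l := one_mul l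
      _ < _ := hlt
      _ ≤ _ := hD.meanOsc_le_dyadicSharp f hy.1
  obtain ⟨𝒜, hcount, hdisj, hU, hA⟩ := hD.exists_maximal_cells (fun y => f y - c) J x₀ l
  have hm : ∀ A ∈ 𝒜, MeasurableSet A := fun A h => by
    obtain ⟨i, -, x, rfl, -⟩ := hA A h
    exact hD.measurableSet_cell i x
  have := hcount.to_subtype
  set E := {y | (ratio n + 1) * l < hD.localMaximal J (fun y => f y - c) y} with hE
  set G := {y | γ * l < dyadicSharp D f y} with hG
  have hGm : MeasurableSet G := measurableSet_lt measurable_const (hD.measurable_dyadicSharp f)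
  calc rho n (hD.cell J x₀ ∩ E) ≤ rho n (⋃ A : 𝒜, (A : Set (S n)) ∩ E) := by
        refine measure_mono ?_
        rintro y ⟨hy, hy'⟩
        have : y ∈ ⋃₀ 𝒜 := by
          rw [hU]
          exact ⟨hy, show l < hD.localMaximal J (fun y => f y - c) y from
            lt_of_le_of_lt (le_mul_of_one_le_left' (le_add_left le_rfl)) hy'⟩
        obtain ⟨A, hA𝒜, hyA⟩ := this
        exact Set.mem_iUnion.2 ⟨⟨A, hA𝒜⟩, hyA, hy'⟩
    _ ≤ ∑' A : 𝒜, rho n ((A : Set (S n)) ∩ E) := measure_iUnion_le _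
    _ ≤ ∑' A : 𝒜, (rho n ((A : Set (S n)) ∩ G) + γ * rho n (A : Set (S n))) := by
        refine ENNReal.tsum_le_tsum fun A => ?_
        obtain ⟨i, hi, x, hx, hsub, hlA, hmax⟩ := hA A A.2
        rw [hx] at hsub hlA ⊢
        refine hD.measure_cell_inter_le hf c (lt_of_le_of_ne hi fun h => ?_) hl0 hl hmax
        subst h
        rw [← hD.cell_eq (hsub (hD.mem_cell i x)), hD.cell_eq (hD.mem_cell i x)] at hosc
        rw [← hosc] at hlA
        rw [← hD.cell_eq (hsub (hD.mem_cell i x)), hD.cell_eq (hD.mem_cell i x)] at hge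
        exact absurd hlA hge.not_gt
    _ = rho n (⋃₀ 𝒜 ∩ G) + γ * rho n (⋃₀ 𝒜) := by
        rw [ENNReal.tsum_add, ENNReal.tsum_mul_left, measure_sUnion hcount hdisj hm,
          Set.sUnion_eq_iUnion, Set.iUnion_inter, measure_iUnion]
        · intro A B hAB
          exact (hdisj A.2 B.2 (fun h => hAB (Subtype.ext h))).mono Set.inter_subset_left
            Set.inter_subset_left
        · exact fun A => (hm A A.2).inter hGm
    _ ≤ _ := by
        rw [hU]
        gcongr
        exact Set.inter_subset_left

end IsDyadicGrid

/-! ### Lebesgue differentiation along the cells -/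

theorem measure_closedBall (x : S n) {r : ℝ} (hr : 0 ≤ r) :
    rho n (Metric.closedBall x r) = ENNReal.ofReal ((2 * r) ^ (n + 1)) := by
  rw [show x = (x.1, x.2) from rfl, ← closedBall_prod_same, rho, Measure.volume_eq_prod,
    Measure.prod_prod, Real.volume_pi_closedBall _ hr, Real.volume_closedBall,
    ← ENNReal.ofReal_mul (by positivity), Fintype.card_fin, pow_succ]

theorem convex_cube_prod_Ico (k : ℤ) (m : Fin n → ℤ) (a b : ℝ) :
    Convex ℝ (dyadicCube k m ×ˢ Set.Ico a b) := by
  rw [dyadicCube_eq_pi]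
  exact (convex_pi fun i _ => convex_Ico _ _).prod (convex_Ico _ _)

/-- The frontier of a convex set is null. Vitali families consist of closed sets, so cells enter
through their closures. -/
theorem IsCZSet.closure_ae_eq {R : Set (S n)} (h : IsCZSet R) : closure R =ᵐ[rho n] R := by
  obtain ⟨k, m, t, r, -, -, rfl⟩ := h
  rw [rho, Measure.volume_eq_prod]
  exact closure_ae_eq_of_null_frontier ((convex_cube_prod_Ico k m _ _).addHaar_frontier _)

theorem Admissible.exp_mul_le {L t r s : ℝ} (h : Admissible L t r) (hr : 0 < r) (hs : s < t + r) :
    Real.exp s * r ≤ L := by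
  rcases lt_or_ge r 1 with h1 | h1
  · refine le_trans ?_ (h.1 h1).1
    rw [← Real.exp_add]
    gcongr
    linarith
  · refine le_trans ?_ (h.2 h1).1
    have : r ≤ Real.exp r := by linarith [Real.add_one_le_exp r]
    calc Real.exp s * r ≤ Real.exp (t + r) * Real.exp r := by gcongr
      _ = _ := by rw [← Real.exp_add, ← Real.exp_add]; ring_nf

/-- The exponent `9` is the `8` of the definition plus `1`, since `t ≤ s + r < s + 1`. With
`Admissible.exp_mul_le` it bounds the eccentricity of small sets in terms of the height `s` of any
of their points. -/
theorem Admissible.le_exp_mul {L t r s : ℝ} (h : Admissible L t r) (hr : 0 < r) (h1 : r < 1)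
    (hs : t - r ≤ s) : L ≤ Real.exp (s + 9) * r := by
  refine (h.1 h1).2.le.trans ?_
  rw [← Real.exp_add]
  exact mul_le_mul_of_nonneg_right (Real.exp_le_exp.2 (by linarith)) hr.le

theorem cube_prod_Ico_subset_closedBall {k : ℤ} {m : Fin n → ℤ} {t r ϱ : ℝ}
    (h1 : (2 : ℝ) ^ k ≤ ϱ) (h2 : 2 * r ≤ ϱ) {x : S n}
    (hx : x ∈ dyadicCube k m ×ˢ Set.Ico (t - r) (t + r)) :
    dyadicCube k m ×ˢ Set.Ico (t - r) (t + r) ⊆ Metric.closedBall x ϱ := by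
  rintro y ⟨hy1, hy2⟩
  obtain ⟨hx1, hx2⟩ := hx
  have h0 : 0 ≤ ϱ := (zpow_pos (two_pos : (0 : ℝ) < 2) k).le.trans h1
  rw [Metric.mem_closedBall, Prod.dist_eq]
  refine max_le ((dist_pi_le_iff h0).2 fun i => ?_) ?_
  · have a := hy1 i
    have b := hx1 i
    rw [Real.dist_eq, abs_le]
    constructor <;> linarith [a.1, a.2, b.1, b.2]
  · rw [Real.dist_eq, abs_le]
    constructor <;> linarith [hy2.1, hy2.2, hx2.1, hx2.2]

/-- The Vitali family of the sets with eccentricity controlled by `m`. -/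
def eccentricFamily (n m : ℕ) : VitaliFamily (rho n) :=
  Vitali.vitaliFamily (rho n) ((12 * (m + 1)) ^ (n + 1) * (m + 1) ^ n) fun x =>
    Eventually.frequently <| eventually_nhdsWithin_of_forall fun r (hr : 0 < r) => by
      rw [measure_closedBall x (by positivity), measure_closedBall x hr.le]
      rw [show 2 * (3 * r) = 3 * (2 * r) by ring, mul_pow, ENNReal.ofReal_mul (by positivity)]
      gcongr
      rw [ENNReal.ofReal_pow (by norm_num)]
      push_cast
      calc ENNReal.ofReal 3 ^ (n + 1) = 3 ^ (n + 1) * 1 := by simp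
        _ ≤ _ := by
          gcongr
          · calc (3 : ℝ≥0∞) = 3 * 1 := (mul_one _).symm
              _ ≤ 12 * ((m : ℝ≥0∞) + 1) := by
                gcongr
                · norm_num
                · exact le_add_self
          · exact one_le_pow₀ le_add_self

theorem cube_prod_Ico_mem_eccentricFamily {k : ℤ} {q : Fin n → ℤ} {t r : ℝ} (hr : 0 < r) {m : ℕ}
    (h1 : (2 : ℝ) ^ k ≤ (m + 1) * r) (h2 : r ≤ (m + 1) * (2 : ℝ) ^ k)
    (hR : IsCZSet (dyadicCube k q ×ˢ Set.Ico (t - r) (t + r))) {x : S n}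
    (hx : x ∈ dyadicCube k q ×ˢ Set.Ico (t - r) (t + r)) :
    closure (dyadicCube k q ×ˢ Set.Ico (t - r) (t + r)) ∈ (eccentricFamily n m).setsAt x := by
  refine ⟨isClosed_closure, hR.nonempty_interior.mono (interior_mono subset_closure),
    -- This radius dominates both the side of the cube and the length `2 r`. Tripling it gives the
    -- factor `12 (m + 1)` in the constant of the family.
    2 * (m + 1) * r, closure_minimal (cube_prod_Ico_subset_closedBall ?_ ?_ hx)
      Metric.isClosed_closedBall, ?_⟩
  · nlinarith [zpow_pos (two_pos : (0 : ℝ) < 2) k]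
  · have : (0 : ℝ) ≤ m := by positivity
    nlinarith
  · rw [measure_congr hR.closure_ae_eq, volume_cube_prod_Ico, measure_closedBall x (by positivity),
      ← ENNReal.ofReal_pow (by positivity), ← ENNReal.ofReal_mul (by positivity)]
    have hC : (((12 * (m + 1)) ^ (n + 1) * (m + 1) ^ n : ℝ≥0) : ℝ≥0∞) =
        ENNReal.ofReal ((12 * (m + 1)) ^ (n + 1) * (m + 1) ^ n) := by
      rw [← ENNReal.ofReal_coe_nnreal]; push_cast; rfl
    rw [hC, ← ENNReal.ofReal_mul (by positivity)]
    refine ENNReal.ofReal_le_ofReal ?_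
    have h3 : r ^ n ≤ (m + 1) ^ n * ((2 : ℝ) ^ k) ^ n := by
      rw [← mul_pow]; gcongr
    calc (2 * (3 * (2 * (m + 1) * r))) ^ (n + 1)
        = (12 * (m + 1)) ^ (n + 1) * (r ^ n * r) := by
          rw [← pow_succ, ← mul_pow]; ring_nf
      _ ≤ (12 * (m + 1)) ^ (n + 1) * (((m + 1) ^ n * ((2 : ℝ) ^ k) ^ n) * (2 * r)) := by
          gcongr; linarith
      _ = _ := by ring

namespace IsDyadicGrid

variable {D : ℤ → Set (Set (S n))} (hD : IsDyadicGrid D)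
include hD

theorem tendsto_measure_cell_atBot (x : S n) :
    Tendsto (fun i : ℕ => rho n (hD.cell (-i) x)) atTop (𝓝 0) :=
  (hD.tendsto_measure x (fun j => hD.cell j x) fun j => ⟨hD.cell_mem j x, hD.mem_cell j x⟩).1.comp
    (tendsto_neg_atTop_atBot.comp tendsto_natCast_atTop_atTop)

theorem tendsto_measure_cell_atTop (x : S n) :
    Tendsto (fun i : ℕ => rho n (hD.cell i x)) atTop (𝓝 ∞) :=
  (hD.tendsto_measure x (fun j => hD.cell j x) fun j => ⟨hD.cell_mem j x, hD.mem_cell j x⟩).2.comp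
    tendsto_natCast_atTop_atTop

/-- The admissible eccentricity depends on the height of `x`, so countably many Vitali families are
used and `m` is chosen pointwise. -/
theorem tendsto_closure_cell (x : S n) {m : ℕ} (hm : Real.exp (|x.2| + 9) ≤ m) :
    Tendsto (fun i : ℕ => closure (hD.cell (-i) x)) atTop ((eccentricFamily n m).filterAt x) := by
  choose k q t r hr hadm heq using fun i : ℕ => hD.isCZSet_cell (-i) x
  have hx : ∀ i : ℕ, x ∈ dyadicCube (k i) (q i) ×ˢ Set.Ico (t i - r i) (t i + r i) := fun i => by
    rw [← heq i]; exact hD.mem_cell _ _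
  have hm1 : (1 : ℝ) ≤ m := le_trans (Real.one_le_exp (by positivity)) hm
  have hlow : ∀ i, r i ≤ m * (2 : ℝ) ^ k i := fun i => by
    have h1 := (hadm i).exp_mul_le (hr i) (hx i).2.2
    have h2 : 1 ≤ m * Real.exp x.2 := by
      calc (1 : ℝ) = Real.exp (-x.2) * Real.exp x.2 := by rw [← Real.exp_add]; simp
        _ ≤ m * Real.exp x.2 := by
          gcongr
          refine le_trans ?_ hm
          gcongr
          linarith [neg_abs_le x.2]
    calc r i ≤ (m * Real.exp x.2) * r i := le_mul_of_one_le_left (hr i).le h2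
      _ = m * (Real.exp x.2 * r i) := by ring
      _ ≤ _ := by gcongr
  have hup : ∀ i, r i < 1 → (2 : ℝ) ^ k i ≤ m * r i := fun i h1 => by
    refine ((hadm i).le_exp_mul (hr i) h1 (hx i).2.1).trans ?_
    have := hr i
    gcongr
    refine le_trans ?_ hm
    gcongr
    exact le_abs_self _
  -- The side is at least `r / m`, so the measure of a cell is at least `r^{n+1} / m^n`; measures
  -- tending to `0` force the radii to do so.
  have hsmall : ∀ ε : ℝ, 0 < ε → ∀ᶠ i in atTop, r i < ε := fun ε hε => by
    have hpos : (0 : ℝ≥0∞) < ENNReal.ofReal (ε ^ (n + 1) / m ^ n) := by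
      rw [ENNReal.ofReal_pos]; positivity
    filter_upwards [(hD.tendsto_measure_cell_atBot x).eventually_lt_const hpos] with i hi
    by_contra! hcon
    refine absurd hi (not_lt.2 ?_)
    rw [heq i, volume_cube_prod_Ico, ← ENNReal.ofReal_pow (by positivity),
      ← ENNReal.ofReal_mul (by positivity)]
    refine ENNReal.ofReal_le_ofReal ?_
    rw [div_le_iff₀ (by positivity)]
    have := hr i
    calc ε ^ (n + 1) ≤ r i ^ n * r i := by rw [← pow_succ]; gcongr
      _ ≤ (m * (2 : ℝ) ^ k i) ^ n * (2 * r i) := by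
        gcongr
        · exact hlow i
        · linarith
      _ = _ := by rw [mul_pow]; ring
  rw [VitaliFamily.tendsto_filterAt_iff]
  constructor
  · filter_upwards [hsmall 1 one_pos] with i hi
    have hcz := hD.isCZSet_cell (-i) x
    rw [heq i] at hcz ⊢
    refine cube_prod_Ico_mem_eccentricFamily (hr i) ?_ ?_ hcz (hx i)
    · nlinarith [hup i hi, hr i]
    · nlinarith [hlow i, zpow_pos (two_pos : (0 : ℝ) < 2) (k i)]
  · intro ε hε
    filter_upwards [hsmall 1 one_pos, hsmall (ε / (2 * m)) (by positivity)] with i hi hi'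
    rw [heq i]
    rw [lt_div_iff₀ (by positivity)] at hi'
    refine closure_minimal (cube_prod_Ico_subset_closedBall ?_ ?_ (hx i))
      Metric.isClosed_closedBall
    · nlinarith [hup i hi, hr i]
    · nlinarith [hr i]

/-- Lebesgue differentiation along the cells of a dyadic grid. -/
theorem ae_tendsto_average_cell {f : S n → ℂ} (hf : LocallyIntegrable f (rho n)) :
    ∀ᵐ x ∂(rho n), Tendsto (fun i : ℕ => ⨍ y in hD.cell (-i) x, f y ∂(rho n)) atTop
      (𝓝 (f x)) := by
  have h : ∀ᵐ x ∂(rho n), ∀ m : ℕ, Tendsto (fun a => ⨍ y in a, f y ∂(rho n))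
      ((eccentricFamily n m).filterAt x) (𝓝 (f x)) :=
    ae_all_iff.2 fun m => (eccentricFamily n m).ae_tendsto_average hf
  filter_upwards [h] with x hx
  obtain ⟨m, hm⟩ := exists_nat_ge (Real.exp (|x.2| + 9))
  refine ((hx m).comp (hD.tendsto_closure_cell x hm)).congr fun i => ?_
  exact setAverage_congr (hD.isCZSet_cell _ x).closure_ae_eq

theorem ae_enorm_sub_le_localMaximal {f : S n → ℂ} (hf : LocallyIntegrable f (rho n)) :
    ∀ᵐ x ∂(rho n), ∀ (c : ℂ) (J : ℤ), ‖f x - c‖ₑ ≤ hD.localMaximal J (fun y => f y - c) x := by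
  filter_upwards [hD.ae_tendsto_average_cell hf] with x hx c J
  have h1 : Tendsto (fun i : ℕ => ‖(⨍ y in hD.cell (-i) x, f y ∂(rho n)) - c‖ₑ) atTop
      (𝓝 ‖f x - c‖ₑ) := ((hx.sub_const c).enorm)
  refine le_of_tendsto h1 ?_
  filter_upwards [eventually_ge_atTop (-J).toNat] with i hi
  have h0 := hD.measure_cell_ne_zero (-i) x
  have h0' := hD.measure_cell_ne_top (-i) x
  rw [← average_sub_const ((hD.isCZSet_cell _ x).integrableOn hf) h0 h0']
  exact (enorm_average_le _ _).trans (le_iSup₂_of_le (-i : ℤ) (by lia) le_rfl)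

end IsDyadicGrid

/-! ### From local to global estimates -/

theorem rpow_add_le_two_rpow_mul (a b : ℝ≥0∞) {p : ℝ} (hp : 0 < p) :
    (a + b) ^ p ≤ 2 ^ p * (a ^ p + b ^ p) := by
  have h : a + b ≤ 2 * max a b := by
    rw [two_mul]; exact add_le_add (le_max_left _ _) (le_max_right _ _)
  calc (a + b) ^ p ≤ (2 * max a b) ^ p := ENNReal.rpow_le_rpow h hp.le
    _ = 2 ^ p * (max a b) ^ p := ENNReal.mul_rpow_of_nonneg _ _ hp.le
    _ ≤ _ := by
      gcongr
      rcases max_cases a b with h | h <;> rw [h.1]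
      · exact le_self_add
      · exact le_add_self

/-- The constant of the `Lᵖ` estimate for the local maximal function. -/
def localConst (n : ℕ) (p : ℝ) : ℝ≥0∞ :=
  ENNReal.ofReal (2 * ((ratio n).toReal + 1) ^ p * (2 * ((ratio n).toReal + 1) ^ p) ^ p)

/-- The ratio of the geometric series that bounds the sum of the differences of the means. -/
def meanDecay (p : ℝ) : ℝ := (2 / 3 : ℝ) ^ p⁻¹

theorem meanDecay_nonneg (p : ℝ) : 0 ≤ meanDecay p := by rw [meanDecay]; positivity

theorem meanDecay_lt_one {p : ℝ} (hp : 0 < p) : meanDecay p < 1 :=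
  Real.rpow_lt_one (by norm_num) (by norm_num) (by positivity)

/-- The constant that bounds the mean over a set by its share of the sharp function. -/
def meanConst (n : ℕ) (p : ℝ) : ℝ≥0∞ := ratio n * ENNReal.ofReal (1 - meanDecay p)⁻¹

/-- The constant of the `Lᵖ` estimate for the dyadic maximal function. -/
def globalConst (n : ℕ) (p : ℝ) : ℝ≥0∞ := 2 ^ p * (localConst n p + meanConst n p ^ p)

theorem globalConst_ne_top (n : ℕ) {p : ℝ} (hp : 0 < p) : globalConst n p ≠ ∞ :=
  ENNReal.mul_ne_top (ENNReal.rpow_ne_top_of_nonneg hp.le (by norm_num)) <|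
    ENNReal.add_ne_top.2 ⟨ENNReal.ofReal_ne_top, ENNReal.rpow_ne_top_of_nonneg hp.le <|
      ENNReal.mul_ne_top ratio_ne_top ENNReal.ofReal_ne_top⟩

namespace IsDyadicGrid

variable {D : ℤ → Set (Set (S n))} (hD : IsDyadicGrid D)
include hD

theorem lintegral_localMaximal_sub_average_rpow_le {f : S n → ℂ}
    (hf : LocallyIntegrable f (rho n)) {p : ℝ} (hp : 0 < p) (J : ℤ) (x₀ : S n) {c : ℂ}
    (hc : c = ⨍ y in hD.cell J x₀, f y ∂(rho n)) :
    ∫⁻ y in hD.cell J x₀, hD.localMaximal J (fun y => f y - c) y ^ p ∂(rho n) ≤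
      localConst n p * ∫⁻ y in hD.cell J x₀, dyadicSharp D f y ^ p ∂(rho n) := by
  set b : ℝ := (ratio n).toReal + 1 with hb
  have hb1 : 1 ≤ b := le_add_of_nonneg_left ENNReal.toReal_nonneg
  have hbp : 1 ≤ b ^ p := Real.one_le_rpow hb1 hp.le
  have hb' : ∀ t : ℝ, 0 < t → ENNReal.ofReal (b * t) = (ratio n + 1) * ENNReal.ofReal t := by
    intro t ht
    rw [ENNReal.ofReal_mul (by positivity), hb, ENNReal.ofReal_add ENNReal.toReal_nonneg
      zero_le_one, ENNReal.ofReal_toReal ratio_ne_top, ENNReal.ofReal_one]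
  have : IsFiniteMeasure ((rho n).restrict (hD.cell J x₀)) :=
    ⟨by rw [Measure.restrict_apply_univ]; exact (hD.measure_cell_ne_top J x₀).lt_top⟩
  have hγ1 : (2 * b ^ p)⁻¹ ≤ 1 := inv_le_one_of_one_le₀ (by linarith)
  have hms := hD.measurable_dyadicSharp f
  have hmM := hD.measurable_localMaximal J (fun y => f y - c)
  -- Here `b = N + 1`, and `γ = (2 b^p)⁻¹` makes `γ b^p` exactly `1/2`.
  have := lintegral_rpow_le_of_good_lambda (μ := (rho n).restrict (hD.cell J x₀))
    (b := b) (γ := (2 * b ^ p)⁻¹) hmM hms hp hb1 (by positivity) hγ1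
    (by rw [mul_inv, mul_assoc, inv_mul_cancel₀ (by positivity)]; norm_num) fun t ht => by
      rw [Measure.restrict_apply (measurableSet_lt measurable_const hmM),
        Measure.restrict_apply (measurableSet_lt measurable_const hms),
        Measure.restrict_apply (measurableSet_lt measurable_const hmM), hb' t ht,
        ENNReal.ofReal_mul (by positivity), Set.inter_comm, Set.inter_comm _ (hD.cell J x₀),
        Set.inter_comm _ (hD.cell J x₀)]
      exact hD.good_lambda hf J x₀ (by simpa using ht) ENNReal.ofReal_ne_top
        (by simpa using hγ1) hc
  rwa [inv_inv] at this

/-- The union of the sets of the grid that contain `x`. -/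
def component (x : S n) : Set (S n) := ⋃ j : ℕ, hD.cell j x

theorem cell_subset_component (j : ℕ) (x : S n) : hD.cell j x ⊆ hD.component x :=
  Set.subset_iUnion (fun j : ℕ => hD.cell j x) j

theorem measurableSet_component (x : S n) : MeasurableSet (hD.component x) :=
  MeasurableSet.iUnion fun j => hD.measurableSet_cell j x

theorem mem_component (x : S n) : x ∈ hD.component x :=
  hD.cell_subset_component 0 x (hD.mem_cell _ x)

theorem component_subset {x z : S n} (hz : z ∈ hD.component x) :
    hD.component z ⊆ hD.component x := by
  obtain ⟨j, hj⟩ := Set.mem_iUnion.1 hz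
  refine Set.iUnion_subset fun k => ?_
  have h1 : z ∈ hD.cell (max j k : ℕ) x := hD.cell_mono (by simp) x hj
  exact (hD.cell_mono (by simp) z).trans
    ((hD.cell_eq h1).subset.trans (hD.cell_subset_component _ x))

theorem component_eq {x z : S n} (hz : z ∈ hD.component x) :
    hD.component z = hD.component x := by
  refine (hD.component_subset hz).antisymm (hD.component_subset ?_)
  obtain ⟨j, hj⟩ := Set.mem_iUnion.1 hz
  refine hD.cell_subset_component j z ?_
  rw [hD.cell_eq hj]
  exact hD.mem_cell _ x

/-- The components form a countable measurable partition of `S`. For `n ≥ 1` there is never just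
one, because each dyadic cube stays in a single orthant. -/
theorem lintegral_le_of_component {g h : S n → ℝ≥0∞}
    (hgh : ∀ x, ∫⁻ y in hD.component x, g y ∂(rho n) ≤ ∫⁻ y in hD.component x, h y ∂(rho n)) :
    ∫⁻ y, g y ∂(rho n) ≤ ∫⁻ y, h y ∂(rho n) := by
  have hdisj : (Set.range hD.component).PairwiseDisjoint id := by
    rintro _ ⟨x, rfl⟩ _ ⟨y, rfl⟩ hne
    refine Set.disjoint_left.2 fun z hz hz' => hne ?_
    rw [← hD.component_eq hz, ← hD.component_eq hz']
  have hcount : (Set.range hD.component).Countable := by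
    refine hdisj.countable_of_nonempty_interior ?_
    rintro _ ⟨x, rfl⟩
    exact (hD.isCZSet_cell 0 x).nonempty_interior.mono
      (interior_mono (hD.cell_subset_component 0 x))
  have hm : ∀ U ∈ Set.range hD.component, MeasurableSet U := by
    rintro _ ⟨x, rfl⟩; exact hD.measurableSet_component x
  have hU : ⋃ U ∈ Set.range hD.component, U = Set.univ :=
    Set.eq_univ_of_forall fun x => Set.mem_biUnion ⟨x, rfl⟩ (hD.mem_component x)
  rw [← setLIntegral_univ g, ← setLIntegral_univ h, ← hU, lintegral_biUnion hcount hm hdisj,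
    lintegral_biUnion hcount hm hdisj]
  refine ENNReal.tsum_le_tsum ?_
  rintro ⟨_, ⟨x, rfl⟩⟩
  exact hgh x

theorem rpow_mul_measure_cell (x : S n) (j i : ℕ) :
    (3 / 2) ^ i * rho n (hD.cell j x) ≤ rho n (hD.cell (j + i : ℕ) x) := by
  induction i with
  | zero => simp
  | succ i ih =>
    have h := hD.measure_cell_le_succ (j + i : ℕ) x
    have h32 : (3 / 2 : ℝ≥0∞) * (2 / 3) = 1 := by
      rw [← ENNReal.inv_div (by simp) (by simp),
        ENNReal.inv_mul_cancel (by simp) (by simp [ENNReal.div_eq_top])]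
    calc (3 / 2) ^ (i + 1) * rho n (hD.cell j x) = 3 / 2 * ((3 / 2) ^ i * rho n (hD.cell j x)) := by
          ring
      _ ≤ 3 / 2 * (2 / 3 * rho n (hD.cell ((j + i : ℕ) + 1) x)) := by
          exact mul_le_mul' le_rfl (ih.trans h)
      _ = _ := by rw [← mul_assoc, h32, one_mul]; push_cast; rw [add_assoc]

/-- The oscillation over a cell is a lower bound for the sharp function at each of its points, so no
Hölder inequality is involved and `p < 1` is allowed. -/
theorem meanOsc_le (f : S n → ℂ) {p : ℝ} (hp : 0 < p) (x : S n) (j : ℕ) :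
    meanOsc f (hD.cell j x) ≤ ((∫⁻ y in hD.component x, dyadicSharp D f y ^ p ∂(rho n)) /
      rho n (hD.cell j x)) ^ p⁻¹ := by
  rw [ENNReal.le_rpow_inv_iff hp, ENNReal.le_div_iff_mul_le (.inl (hD.measure_cell_ne_zero _ x))
    (.inl (hD.measure_cell_ne_top _ x)), ← setLIntegral_const]
  refine (setLIntegral_mono' (hD.measurableSet_cell _ x) fun y hy => ?_).trans
    (lintegral_mono_set (hD.cell_subset_component j x))
  exact ENNReal.rpow_le_rpow (hD.meanOsc_le_dyadicSharp f hy) hp.le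

theorem enorm_average_sub_le {f : S n → ℂ} (hf : LocallyIntegrable f (rho n)) (x : S n) (j : ℤ) :
    ‖(⨍ y in hD.cell j x, f y ∂(rho n)) - ⨍ y in hD.cell (j + 1) x, f y ∂(rho n)‖ₑ ≤
      ratio n * meanOsc f (hD.cell (j + 1) x) := by
  have h0 := hD.measure_cell_ne_zero j x
  have h1 := hD.measure_cell_ne_top j x
  rw [← average_sub_const ((hD.isCZSet_cell j x).integrableOn hf) h0 h1]
  exact (enorm_average_le _ _).trans (meanAbs_le_mul ratio_ne_top (hD.cell_mono (by lia) x) h0 h1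
    (hD.measure_cell_succ_le j x))

/-- The means over the ancestors of a point converge geometrically. -/
theorem exists_tendsto_average {f : S n → ℂ} (hf : LocallyIntegrable f (rho n)) {p : ℝ}
    (hp : 0 < p) (x : S n)
    (hI : ∫⁻ y in hD.component x, dyadicSharp D f y ^ p ∂(rho n) ≠ ∞) :
    ∃ c : ℂ, Tendsto (fun j : ℕ => ⨍ y in hD.cell j x, f y ∂(rho n)) atTop (𝓝 c) ∧
      ∀ j : ℕ, ‖(⨍ y in hD.cell j x, f y ∂(rho n)) - c‖ₑ ≤ meanConst n p *
        ((∫⁻ y in hD.component x, dyadicSharp D f y ^ p ∂(rho n)) /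
          rho n (hD.cell j x)) ^ p⁻¹ := by
  set I := ∫⁻ y in hD.component x, dyadicSharp D f y ^ p ∂(rho n) with hIdef
  set a : ℕ → ℂ := fun j => ⨍ y in hD.cell j x, f y ∂(rho n) with ha
  set B : ℕ → ℝ≥0∞ := fun j => ratio n * (I / rho n (hD.cell j x)) ^ p⁻¹ with hB
  have hBtop : ∀ j, B j ≠ ∞ := fun j => ENNReal.mul_ne_top ratio_ne_top <|
    ENNReal.rpow_ne_top_of_nonneg (by positivity) <|
      ENNReal.div_ne_top hI (hD.measure_cell_ne_zero _ x)
  -- Started at an arbitrary `j`, so that the sum of the geometric series also gives the rate of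
  -- convergence in terms of `ρ` of the cell of generation `j`.
  have hstep : ∀ j i : ℕ, dist (a (j + i)) (a (j + i + 1)) ≤ (B j).toReal * meanDecay p ^ i := by
    intro j i
    have h1 : ‖a (j + i) - a (j + i + 1)‖ₑ ≤ B j * ENNReal.ofReal (meanDecay p ^ i) := by
      have h2 := hD.enorm_average_sub_le hf x (j + i : ℕ)
      have h3 := hD.meanOsc_le f hp x (j + i + 1)
      push_cast at h2 h3
      simp only [ha]
      push_cast
      refine h2.trans ((mul_le_mul' le_rfl h3).trans ?_)
      rw [hB, mul_assoc]
      refine mul_le_mul' le_rfl ?_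
      have hd : ENNReal.ofReal (meanDecay p ^ i) = ((2 / 3 : ℝ≥0∞) ^ i) ^ p⁻¹ := by
        rw [meanDecay, ← Real.rpow_natCast, ← Real.rpow_mul (by norm_num), mul_comm,
          Real.rpow_mul (by norm_num), Real.rpow_natCast,
          ← ENNReal.ofReal_rpow_of_nonneg (by positivity) (by positivity),
          ENNReal.ofReal_pow (by norm_num), ENNReal.ofReal_div_of_pos (by norm_num)]
        norm_num
      rw [hd, ← ENNReal.mul_rpow_of_nonneg _ _ (by positivity)]
      refine ENNReal.rpow_le_rpow ?_ (by positivity)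
      have h4 := hD.rpow_mul_measure_cell x j i
      have h5 : rho n (hD.cell (j + i : ℕ) x) ≤ rho n (hD.cell ((j : ℤ) + i + 1) x) :=
        measure_mono (hD.cell_mono (by push_cast; lia) x)
      calc I / rho n (hD.cell ((j : ℤ) + i + 1) x)
          ≤ I / ((3 / 2) ^ i * rho n (hD.cell j x)) :=
            ENNReal.div_le_div_left (h4.trans h5) _
        _ = _ := by
          rw [ENNReal.div_eq_inv_mul, ENNReal.mul_inv (.inr (hD.measure_cell_ne_top _ x))
            (.inr (hD.measure_cell_ne_zero _ x)), ENNReal.inv_pow,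
            ENNReal.inv_div (by simp) (by simp), div_eq_mul_inv I]
          ring
    rw [dist_eq_norm, ← toReal_enorm]
    refine (ENNReal.toReal_mono (ENNReal.mul_ne_top (hBtop j) ENNReal.ofReal_ne_top) h1).trans ?_
    rw [ENNReal.toReal_mul, ENNReal.toReal_ofReal (pow_nonneg (meanDecay_nonneg p) i)]
  obtain ⟨c, hc⟩ := cauchySeq_tendsto_of_complete
    (cauchySeq_of_le_geometric _ _ (meanDecay_lt_one hp) fun i => by
      simpa using hstep 0 i)
  refine ⟨c, hc, fun j => ?_⟩
  have hcj : Tendsto (fun i => a (j + i)) atTop (𝓝 c) := by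
    refine hc.comp (tendsto_atTop_mono (fun i => ?_) tendsto_id)
    simp
  have h := dist_le_of_le_geometric_of_tendsto₀ _ _ (meanDecay_lt_one hp) (fun i => hstep j i) hcj
  rw [add_zero, dist_eq_norm] at h
  have hq : 0 < 1 - meanDecay p := sub_pos.2 (meanDecay_lt_one hp)
  rw [← ofReal_norm]
  refine (ENNReal.ofReal_le_ofReal h).trans ?_
  rw [ENNReal.ofReal_div_of_pos hq, ENNReal.ofReal_toReal (hBtop j), hB, meanConst,
    ENNReal.ofReal_inv_of_pos hq, ENNReal.div_eq_inv_mul]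
  exact le_of_eq (by ring)

/-- The means over the ancestors of a point tend to `0` if the function is in some `Lᵖ`. -/
theorem enorm_average_le_of_memLp {f : S n → ℂ} (hf : LocallyIntegrable f (rho n)) {p : ℝ}
    (hp : 0 < p) {p₀ : ℝ≥0∞} (hp₀ : p₀ ≠ 0) (hp₀' : p₀ ≠ ∞) (hfp : MemLp f p₀ (rho n)) (x : S n)
    (hI : ∫⁻ y in hD.component x, dyadicSharp D f y ^ p ∂(rho n) ≠ ∞) (j : ℕ) :
    ‖⨍ y in hD.cell j x, f y ∂(rho n)‖ₑ ≤ meanConst n p *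
        ((∫⁻ y in hD.component x, dyadicSharp D f y ^ p ∂(rho n)) /
          rho n (hD.cell j x)) ^ p⁻¹ := by
  obtain ⟨c, hc, hle⟩ := hD.exists_tendsto_average hf hp x hI
  suffices c = 0 by simpa [this] using hle j
  by_contra hc0
  set I := ∫⁻ y in hD.component x, dyadicSharp D f y ^ p ∂(rho n) with hIdef
  -- A third leaves room: once the mean exceeds `2 δ` in modulus, `|f| < δ` forces `f` to differ
  -- from the mean by at least `δ`.
  set δ : ℝ≥0 := ‖c‖₊ / 3 with hδ
  have hcpos : 0 < ‖c‖₊ := nnnorm_pos.2 hc0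
  have hδ0 : δ ≠ 0 := by positivity
  have hbig : ∀ᶠ j : ℕ in atTop, 2 * δ < ‖⨍ y in hD.cell j x, f y ∂(rho n)‖₊ := by
    refine hc.nnnorm.eventually_const_lt ?_
    rw [hδ, ← NNReal.coe_lt_coe]
    push_cast
    have : (0 : ℝ) < ‖c‖ := hcpos
    linarith
  have hfin1 := hfp.meas_ge_lt_top hp₀ hp₀' hδ0
  -- `W` bounds the measure of all late ancestors independently of the generation, and those
  -- measures are unbounded.
  set W := rho n {y | δ ≤ ‖f y‖₊} + localConst n p * I / (δ : ℝ≥0∞) ^ p with hW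
  have hδp0 : (δ : ℝ≥0∞) ^ p ≠ 0 := by
    rw [Ne, ENNReal.rpow_eq_zero_iff_of_pos hp]; exact_mod_cast hδ0
  have hδptop : (δ : ℝ≥0∞) ^ p ≠ ∞ := ENNReal.rpow_ne_top_of_nonneg hp.le ENNReal.coe_ne_top
  have hWtop : W < ∞ := ENNReal.add_lt_top.2 ⟨hfin1, (ENNReal.div_ne_top
    (ENNReal.mul_ne_top ENNReal.ofReal_ne_top hI) hδp0).lt_top⟩
  obtain ⟨J, hJ, hJ'⟩ :=
    (hbig.and ((hD.tendsto_measure_cell_atTop x).eventually_const_lt hWtop)).exists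
  refine absurd hJ' (not_lt.2 ?_)
  set a := ⨍ y in hD.cell J x, f y ∂(rho n) with ha
  have hcov : hD.cell J x ⊆ {y | δ ≤ ‖f y‖₊} ∪
      (hD.cell J x ∩ {y | (δ : ℝ≥0∞) ^ p ≤ ‖f y - a‖ₑ ^ p}) := by
    intro y hy
    rcases le_or_gt δ ‖f y‖₊ with h | h
    · exact .inl h
    · refine .inr ⟨hy, ENNReal.rpow_le_rpow ?_ hp.le⟩
      rw [enorm_eq_nnnorm, ENNReal.coe_le_coe, ← NNReal.coe_le_coe]
      have h1 : 2 * (δ : ℝ) < ‖a‖ := by exact_mod_cast hJ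
      have h2 : ‖f y‖ < δ := by exact_mod_cast h
      have h3 := norm_sub_norm_le a (f y)
      rw [norm_sub_rev] at h3
      rw [coe_nnnorm]
      linarith
  refine (measure_mono hcov).trans ((measure_union_le _ _).trans ?_)
  rw [hW]
  gcongr
  rw [ENNReal.le_div_iff_mul_le (.inl hδp0) (.inl hδptop), mul_comm]
  have hmeas : AEMeasurable (fun y => ‖f y - a‖ₑ ^ p) ((rho n).restrict (hD.cell J x)) := by
    have := (hf.aestronglyMeasurable.sub (aestronglyMeasurable_const (b := a))).enorm.restrict
      (s := hD.cell J x)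
    exact this.pow_const p
  have h1 := mul_meas_ge_le_lintegral₀ hmeas ((δ : ℝ≥0∞) ^ p)
  have h2 : ∫⁻ y in hD.cell J x, ‖f y - a‖ₑ ^ p ∂(rho n) ≤ localConst n p * I := by
    calc ∫⁻ y in hD.cell J x, ‖f y - a‖ₑ ^ p ∂(rho n)
        ≤ ∫⁻ y in hD.cell J x, hD.localMaximal J (fun y => f y - a) y ^ p ∂(rho n) := by
          refine lintegral_mono_ae (ae_restrict_of_ae ?_)
          filter_upwards [hD.ae_enorm_sub_le_localMaximal hf] with y hy
          exact ENNReal.rpow_le_rpow (hy a J) hp.le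
      _ ≤ _ := hD.lintegral_localMaximal_sub_average_rpow_le hf hp J x ha
      _ ≤ _ := by
        exact mul_le_mul' le_rfl (lintegral_mono_set (hD.cell_subset_component J x))
  refine le_trans ?_ (h1.trans h2)
  refine mul_le_mul' le_rfl ?_
  rw [Set.inter_comm]
  exact Measure.le_restrict_apply _ _

/-- On the cell `R` of generation `J` the local maximal function of `f` is at most that of `f - f_R`
plus `|f_R|`, and both contributions are bounded independently of `J`. Monotone convergence in `J`
concludes. -/
theorem lintegral_component_dyadicMaximal_rpow_le {f : S n → ℂ}
    (hf : LocallyIntegrable f (rho n)) {p : ℝ} (hp : 0 < p) {p₀ : ℝ≥0∞} (hp₀ : p₀ ≠ 0)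
    (hp₀' : p₀ ≠ ∞) (hfp : MemLp f p₀ (rho n)) (x : S n)
    (hI : ∫⁻ y in hD.component x, dyadicSharp D f y ^ p ∂(rho n) ≠ ∞) :
    ∫⁻ y in hD.component x, dyadicMaximal D f y ^ p ∂(rho n) ≤
      globalConst n p * ∫⁻ y in hD.component x, dyadicSharp D f y ^ p ∂(rho n) := by
  set I := ∫⁻ y in hD.component x, dyadicSharp D f y ^ p ∂(rho n) with hIdef
  have hloc : ∀ J : ℕ, ∫⁻ y in hD.cell J x, hD.localMaximal J f y ^ p ∂(rho n) ≤
      globalConst n p * I := by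
    intro J
    have h0 := hD.measure_cell_ne_zero J x
    have h1 := hD.measure_cell_ne_top J x
    set a := ⨍ y in hD.cell J x, f y ∂(rho n) with ha
    have hmean : ‖a‖ₑ ^ p * rho n (hD.cell J x) ≤ meanConst n p ^ p * I := by
      have h2 := ENNReal.rpow_le_rpow
        (hD.enorm_average_le_of_memLp hf hp hp₀ hp₀' hfp x hI J) hp.le
      rw [ENNReal.mul_rpow_of_nonneg _ _ hp.le, ENNReal.rpow_inv_rpow hp.ne'] at h2
      calc ‖a‖ₑ ^ p * rho n (hD.cell J x)
          ≤ (meanConst n p ^ p * (I / rho n (hD.cell J x))) * rho n (hD.cell J x) := by gcongr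
        _ = _ := by rw [mul_assoc, ENNReal.div_mul_cancel h0 h1]
    calc ∫⁻ y in hD.cell J x, hD.localMaximal J f y ^ p ∂(rho n)
        ≤ ∫⁻ y in hD.cell J x,
            2 ^ p * (hD.localMaximal J (fun y => f y - a) y ^ p + ‖a‖ₑ ^ p) ∂(rho n) := by
          refine lintegral_mono fun y => ?_
          exact (ENNReal.rpow_le_rpow (hD.localMaximal_le_sub_add J f a y) hp.le).trans
            (rpow_add_le_two_rpow_mul _ _ hp)
      _ = 2 ^ p * ((∫⁻ y in hD.cell J x, hD.localMaximal J (fun y => f y - a) y ^ p ∂(rho n)) +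
            ‖a‖ₑ ^ p * rho n (hD.cell J x)) := by
          rw [lintegral_const_mul' _ _ (ENNReal.rpow_ne_top_of_nonneg hp.le (by norm_num)),
            lintegral_add_right _ measurable_const, setLIntegral_const]
      _ ≤ 2 ^ p * (localConst n p * I + meanConst n p ^ p * I) := by
          refine mul_le_mul' le_rfl (add_le_add ?_ hmean)
          refine (hD.lintegral_localMaximal_sub_average_rpow_le hf hp J x ha).trans ?_
          exact mul_le_mul' le_rfl (lintegral_mono_set (hD.cell_subset_component J x))
      _ = _ := by rw [globalConst]; ring
  set F : ℕ → S n → ℝ≥0∞ := fun J =>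
    (hD.cell J x).indicator fun y => hD.localMaximal J f y ^ p with hF
  have hFmono : Monotone F := by
    intro i j hij y
    by_cases hy : y ∈ hD.cell i x
    · have hy' : y ∈ hD.cell j x := hD.cell_mono (by exact_mod_cast hij) x hy
      simp only [hF, Set.indicator_of_mem hy, Set.indicator_of_mem hy']
      exact ENNReal.rpow_le_rpow (hD.localMaximal_mono (by exact_mod_cast hij) f y) hp.le
    · simp [hF, Set.indicator_of_notMem hy]
  have hFmeas : ∀ J, Measurable (F J) := fun J =>
    ((hD.measurable_localMaximal J f).pow_const p).indicator (hD.measurableSet_cell J x)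
  have hle : ∀ y ∈ hD.component x, dyadicMaximal D f y ^ p ≤ ⨆ J, F J y := by
    intro y hy
    have hsup : dyadicMaximal D f y ^ p = ⨆ i, meanAbs f (hD.cell i y) ^ p := by
      rw [hD.dyadicMaximal_eq]
      exact (ENNReal.orderIsoRpow p hp).map_iSup _
    rw [hsup]
    refine iSup_le fun i => ?_
    obtain ⟨j, hj⟩ := Set.mem_iUnion.1 hy
    refine le_iSup_of_le (max j i.toNat) ?_
    have hy' : y ∈ hD.cell (max j i.toNat : ℕ) x := hD.cell_mono (by simp) x hj
    simp only [hF, Set.indicator_of_mem hy']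
    exact ENNReal.rpow_le_rpow (le_iSup₂_of_le i (by lia) le_rfl) hp.le
  calc ∫⁻ y in hD.component x, dyadicMaximal D f y ^ p ∂(rho n)
      ≤ ∫⁻ y in hD.component x, ⨆ J, F J y ∂(rho n) :=
        setLIntegral_mono' (hD.measurableSet_component x) hle
    _ ≤ ∫⁻ y, ⨆ J, F J y ∂(rho n) := setLIntegral_le_lintegral _ _
    _ = ⨆ J, ∫⁻ y, F J y ∂(rho n) := lintegral_iSup hFmeas hFmono
    _ ≤ _ := iSup_le fun J => by
        simp only [hF]
        rw [lintegral_indicator (hD.measurableSet_cell J x)]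
        exact hloc J

/-- The dyadic Fefferman–Stein inequality. -/
theorem lintegral_dyadicMaximal_rpow_le {f : S n → ℂ} (hf : LocallyIntegrable f (rho n)) {p : ℝ}
    (hp : 0 < p) {p₀ : ℝ≥0∞} (hp₀ : p₀ ≠ 0) (hp₀' : p₀ ≠ ∞) (hfp : MemLp f p₀ (rho n))
    (hI : ∫⁻ y, dyadicSharp D f y ^ p ∂(rho n) ≠ ∞) :
    ∫⁻ y, dyadicMaximal D f y ^ p ∂(rho n) ≤
      globalConst n p * ∫⁻ y, dyadicSharp D f y ^ p ∂(rho n) := by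
  rw [← lintegral_const_mul' _ _ (globalConst_ne_top n hp)]
  refine hD.lintegral_le_of_component fun x => ?_
  rw [lintegral_const_mul' _ _ (globalConst_ne_top n hp)]
  exact hD.lintegral_component_dyadicMaximal_rpow_le hf hp hp₀ hp₀' hfp x
    (ne_top_of_le_ne_top hI (setLIntegral_le_lintegral _ _))

theorem ae_enorm_le_dyadicMaximal {f : S n → ℂ} (hf : LocallyIntegrable f (rho n)) :
    ∀ᵐ x ∂(rho n), ‖f x‖ₑ ≤ dyadicMaximal D f x := by
  filter_upwards [hD.ae_enorm_sub_le_localMaximal hf] with x hx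
  have h := hx 0 0
  simp only [sub_zero] at h
  refine h.trans ?_
  rw [hD.dyadicMaximal_eq]
  exact iSup₂_le fun i _ => le_iSup (fun i => meanAbs f (hD.cell i x)) i

theorem memLp_of_dyadicMaximal {f : S n → ℂ} (hf : LocallyIntegrable f (rho n)) {q : ℝ≥0∞}
    (h : eLpNorm (dyadicMaximal D f) q (rho n) < ∞) : MemLp f q (rho n) := by
  refine ⟨hf.aestronglyMeasurable, lt_of_le_of_lt ?_ h⟩
  exact eLpNorm_mono_enorm_ae (by simpa using hD.ae_enorm_le_dyadicMaximal hf)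

/-- The dyadic Fefferman–Stein inequality, in terms of `Lᵖ` norms. -/
theorem eLpNorm_dyadicMaximal_le {f : S n → ℂ} (hf : LocallyIntegrable f (rho n)) {p : ℝ≥0∞}
    (hp : p ≠ 0) (hp' : p ≠ ∞) {p₀ : ℝ≥0∞} (hp₀ : p₀ ≠ 0) (hp₀' : p₀ ≠ ∞)
    (hfp : MemLp f p₀ (rho n)) (hs : eLpNorm (dyadicSharp D f) p (rho n) < ∞) :
    eLpNorm (dyadicMaximal D f) p (rho n) ≤
      globalConst n p.toReal ^ (p.toReal)⁻¹ * eLpNorm (dyadicSharp D f) p (rho n) := by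
  have hpos := ENNReal.toReal_pos hp hp'
  rw [eLpNorm_eq_lintegral_rpow_enorm_toReal hp hp'] at hs ⊢
  rw [eLpNorm_eq_lintegral_rpow_enorm_toReal hp hp']
  simp only [enorm_eq_self, one_div] at hs ⊢
  rw [← ENNReal.mul_rpow_of_nonneg _ _ (by positivity)]
  refine ENNReal.rpow_le_rpow ?_ (by positivity)
  refine hD.lintegral_dyadicMaximal_rpow_le hf hpos hp₀ hp₀' hfp fun h => ?_
  rw [h, ENNReal.top_rpow_of_pos (by positivity)] at hs
  exact lt_irrefl _ hs

end IsDyadicGrid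

/-! ### Tiles

A tile describes all products `Q × [t - r, t + r)` with `Q` a dyadic cube of side length `2 ^ k`. -/

/-- The parameters of a Calderón–Zygmund set, up to the position of its cube. -/
structure Tile where
  /-- the centre of the interval -/
  t : ℝ
  /-- the radius of the interval -/
  r : ℝ
  /-- the scale of the cubes -/
  k : ℤ

/-- The least admissible side length. -/
def minSide (t r : ℝ) : ℝ :=
  if r < 1 then Real.exp 2 * Real.exp t * r else Real.exp t * Real.exp (2 * r)

theorem minSide_of_one_le {t r : ℝ} (h : 1 ≤ r) : minSide t r = Real.exp (t + 2 * r) := by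
  rw [minSide, if_neg h.not_gt, Real.exp_add]

theorem minSide_pos {t r : ℝ} (h : 0 < r) : 0 < minSide t r := by
  rw [minSide]; split_ifs <;> positivity

theorem Admissible.minSide_le {L t r : ℝ} (h : Admissible L t r) : minSide t r ≤ L := by
  rw [minSide]
  split_ifs with h1
  · exact (h.1 h1).1
  · exact (h.2 (not_lt.1 h1)).1

theorem Admissible.half_side {L t r : ℝ} (h : Admissible L t r) (hL : 0 < L)
    (h1 : 2 * minSide t r ≤ L) : Admissible (L / 2) t r := by
  rw [minSide] at h1
  refine ⟨fun hr => ?_, fun hr => ?_⟩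
  · rw [if_pos hr] at h1
    exact ⟨by linarith, by linarith [(h.1 hr).2]⟩
  · rw [if_neg hr.not_gt] at h1
    exact ⟨by linarith, by linarith [(h.2 hr).2]⟩

/-- Since `L` is within a factor `2` of the least admissible side, the gap between the exponents `2`
and `8` absorbs the change of centre and radius. The cases are `r < 1`, `1 ≤ r < 2`, where the half
radius falls into the other regime, and `r ≥ 2`. The two halves of the interval are `s = ± r / 2`.
-/
theorem Admissible.half_radius {L t r s : ℝ} (h : Admissible L t r) (hr : 0 < r)
    (h1 : L < 2 * minSide t r) (hs : |s| ≤ r / 2) : Admissible L (t + s) (r / 2) := by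
  have hs1 := (abs_le.1 hs).1
  have hs2 := (abs_le.1 hs).2
  have hlow := h.minSide_le
  rw [minSide] at h1 hlow
  rcases lt_or_ge r 1 with hr1 | hr1
  · rw [if_pos hr1] at h1 hlow
    refine ⟨fun _ => ⟨?_, ?_⟩, fun h' => by linarith⟩
    · refine le_trans ?_ hlow
      have h2 : Real.exp s ≤ 2 := by
        rw [← Real.le_log_iff_exp_le two_pos]
        linarith [Real.log_two_gt_d9]
      rw [Real.exp_add]
      calc Real.exp 2 * (Real.exp t * Real.exp s) * (r / 2)
          ≤ Real.exp 2 * (Real.exp t * 2) * (r / 2) := by gcongr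
        _ = _ := by ring
    · refine h1.trans_le ?_
      have h2 : 4 ≤ Real.exp (6 + s) := by linarith [Real.add_one_le_exp (6 + s)]
      calc 2 * (Real.exp 2 * Real.exp t * r) = 4 * (Real.exp 2 * Real.exp t) * (r / 2) := by ring
        _ ≤ Real.exp (6 + s) * (Real.exp 2 * Real.exp t) * (r / 2) := by gcongr
        _ = _ := by simp only [← Real.exp_add]; ring_nf
  · rw [if_neg hr1.not_gt] at h1 hlow
    refine ⟨fun h' => ⟨?_, ?_⟩, fun h' => ⟨?_, ?_⟩⟩
    · refine le_trans ?_ hlow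
      have h2 : r / 2 ≤ Real.exp (3 / 2 * r - 2) := by
        linarith [Real.add_one_le_exp (3 / 2 * r - 2)]
      calc Real.exp 2 * Real.exp (t + s) * (r / 2)
          ≤ Real.exp 2 * Real.exp (t + r / 2) * Real.exp (3 / 2 * r - 2) := by gcongr
        _ = _ := by simp only [← Real.exp_add]; ring_nf
    · refine h1.trans_le ?_
      have h2 : 4 ≤ Real.exp (8 + s - 2 * r) := by linarith [Real.add_one_le_exp (8 + s - 2 * r)]
      calc 2 * (Real.exp t * Real.exp (2 * r)) = 4 * (Real.exp t * Real.exp (2 * r)) * (1 / 2) := by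
            ring
        _ ≤ Real.exp (8 + s - 2 * r) * (Real.exp t * Real.exp (2 * r)) * (r / 2) := by gcongr
        _ = _ := by simp only [← Real.exp_add]; ring_nf
    · refine le_trans ?_ hlow
      rw [← Real.exp_add, ← Real.exp_add]
      exact Real.exp_le_exp.2 (by linarith)
    · refine h1.trans_le ?_
      have h2 : 2 ≤ Real.exp (s + 2 * r) := by linarith [Real.add_one_le_exp (s + 2 * r)]
      calc 2 * (Real.exp t * Real.exp (2 * r))
          ≤ Real.exp (s + 2 * r) * (Real.exp t * Real.exp (2 * r)) := by gcongr
        _ = _ := by simp only [← Real.exp_add]; ring_nf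

namespace Tile

/-- The interval of a tile. -/
def interval (T : Tile) : Set ℝ := Set.Ico (T.t - T.r) (T.t + T.r)

/-- The products described by the tile are Calderón–Zygmund sets. -/
def IsAdmissible (T : Tile) : Prop := 0 < T.r ∧ Admissible ((2 : ℝ) ^ T.k) T.t T.r

/-- The left half of a tile. -/
def left (T : Tile) : Tile := ⟨T.t - T.r / 2, T.r / 2, T.k⟩

/-- The right half of a tile. -/
def right (T : Tile) : Tile := ⟨T.t + T.r / 2, T.r / 2, T.k⟩

/-- The tile with the cubes subdivided. -/
def refine (T : Tile) : Tile := ⟨T.t, T.r, T.k - 1⟩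

/-- The cubes are too small to be subdivided. -/
def IsShort (T : Tile) : Prop := (2 : ℝ) ^ T.k < 2 * minSide T.t T.r

open Classical in
/-- The children of a tile: the cubes are subdivided if possible, and the interval otherwise. -/
def children (T : Tile) : Set Tile := if T.IsShort then {T.left, T.right} else {T.refine}

theorem IsAdmissible.of_mem_children {T T' : Tile} (h : T.IsAdmissible) (hT' : T' ∈ T.children) :
    T'.IsAdmissible := by
  obtain ⟨hr, ha⟩ := h
  rw [children] at hT'
  split_ifs at hT' with hs
  · rcases hT' with rfl | rfl
    · refine ⟨half_pos hr, ?_⟩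
      have := ha.half_radius (s := -(T.r / 2)) hr hs (by rw [abs_neg, abs_of_pos (half_pos hr)])
      rwa [← sub_eq_add_neg] at this
    · exact ⟨half_pos hr, ha.half_radius hr hs (by rw [abs_of_pos (half_pos hr)])⟩
  · rw [Set.mem_singleton_iff] at hT'
    subst hT'
    refine ⟨hr, ?_⟩
    have := ha.half_side (by positivity) (not_lt.1 hs)
    rwa [div_eq_mul_inv, ← zpow_sub_one₀ two_ne_zero] at this

theorem interval_left_union_right {T : Tile} (hr : 0 < T.r) :
    T.left.interval ∪ T.right.interval = T.interval := by
  simp only [interval, left, right]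
  rw [show T.t - T.r / 2 - T.r / 2 = T.t - T.r by ring,
    show T.t - T.r / 2 + T.r / 2 = T.t by ring, show T.t + T.r / 2 - T.r / 2 = T.t by ring,
    show T.t + T.r / 2 + T.r / 2 = T.t + T.r by ring]
  exact Set.Ico_union_Ico_eq_Ico (by linarith) (by linarith)

theorem disjoint_interval_left_right (T : Tile) :
    Disjoint T.left.interval T.right.interval := by
  refine Set.disjoint_left.2 fun x hx hx' => ?_
  have h1 := hx.2
  have h2 := hx'.1
  simp only [left, right] at h1 h2
  linarith

theorem biUnion_children {T : Tile} (hr : 0 < T.r) :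
    ⋃ T' ∈ T.children, T'.interval = T.interval := by
  rw [children]
  split_ifs
  · rw [Set.biUnion_pair, interval_left_union_right hr]
  · rw [Set.biUnion_singleton]; rfl

theorem pairwiseDisjoint_children (T : Tile) : T.children.PairwiseDisjoint interval := by
  rw [children]
  split_ifs
  · rintro A (rfl | rfl) B (rfl | rfl) hne
    · exact absurd rfl hne
    · exact T.disjoint_interval_left_right
    · exact T.disjoint_interval_left_right.symm
    · exact absurd rfl hne
  · exact Set.pairwiseDisjoint_singleton _ _

/-- The descendants of a tile after `i` generations. -/
def descendants : ℕ → Tile → Set Tile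
  | 0, T => {T}
  | i + 1, T => ⋃ T' ∈ descendants i T, T'.children

theorem IsAdmissible.of_mem_descendants {T : Tile} (h : T.IsAdmissible) {i : ℕ} :
    ∀ {T' : Tile}, T' ∈ descendants i T → T'.IsAdmissible := by
  induction i with
  | zero => rintro T' rfl; exact h
  | succ i ih =>
    intro T' hT'
    obtain ⟨A, hA, hT'⟩ := Set.mem_iUnion₂.1 hT'
    exact (ih hA).of_mem_children hT'

theorem biUnion_descendants {T : Tile} (h : T.IsAdmissible) (i : ℕ) :
    ⋃ T' ∈ descendants i T, T'.interval = T.interval := by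
  induction i with
  | zero => simp [descendants]
  | succ i ih =>
    rw [← ih, descendants, Set.biUnion_iUnion]
    refine Set.iUnion_congr fun A => ?_
    rw [Set.biUnion_iUnion]
    exact Set.iUnion_congr fun hA => biUnion_children (h.of_mem_descendants hA).1

theorem pairwiseDisjoint_descendants {T : Tile} (h : T.IsAdmissible) (i : ℕ) :
    (descendants i T).PairwiseDisjoint interval := by
  induction i with
  | zero => exact Set.pairwiseDisjoint_singleton _ _
  | succ i ih =>
    intro A hA B hB hne
    obtain ⟨A', hA', hA⟩ := Set.mem_iUnion₂.1 hA
    obtain ⟨B', hB', hB⟩ := Set.mem_iUnion₂.1 hB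
    by_cases hAB : A' = B'
    · subst hAB
      exact A'.pairwiseDisjoint_children hA hB hne
    · refine (ih hA' hB' hAB).mono ?_ ?_
      · rw [← biUnion_children (h.of_mem_descendants hA').1]
        exact Set.subset_biUnion_of_mem (u := interval) hA
      · rw [← biUnion_children (h.of_mem_descendants hB').1]
        exact Set.subset_biUnion_of_mem (u := interval) hB

end Tile

/-! ### An increasing chain of tiles -/

/-- The least admissible side length for the interval with centre `(-2) ^ m` and radius
`3 * 2 ^ m`. -/
def chainSide (m : ℕ) : ℝ := minSide ((-2) ^ m) (3 * 2 ^ m)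

theorem chainSide_eq (m : ℕ) : chainSide m = Real.exp ((-2) ^ m + 6 * 2 ^ m) := by
  have : (1 : ℝ) ≤ 2 ^ m := one_le_pow₀ one_le_two
  rw [chainSide, minSide_of_one_le (by linarith)]
  ring_nf

theorem abs_neg_two_pow (m : ℕ) : |(-2 : ℝ) ^ m| = 2 ^ m := by
  rw [abs_pow, abs_neg, abs_two]

theorem two_mul_chainSide_le (m : ℕ) : 2 * chainSide m ≤ chainSide (m + 1) := by
  have h1 : (1 : ℝ) ≤ 2 ^ m := one_le_pow₀ one_le_two
  have h2 := abs_le.1 (abs_neg_two_pow m).le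
  have h3 : 2 ≤ Real.exp (3 * 2 ^ m) := by linarith [Real.add_one_le_exp (3 * 2 ^ m : ℝ)]
  rw [chainSide_eq, chainSide_eq]
  calc 2 * Real.exp ((-2) ^ m + 6 * 2 ^ m)
      ≤ Real.exp (3 * 2 ^ m) * Real.exp ((-2) ^ m + 6 * 2 ^ m) := by gcongr
    _ ≤ _ := by
      rw [← Real.exp_add]
      refine Real.exp_le_exp.2 ?_
      rw [pow_succ, pow_succ]
      linarith [h2.1, h2.2]

/-- The right side is the upper admissible bound `exp (t + 8 r)` of the `m`-th interval. Its cubes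
may therefore grow until they suit the next interval. -/
theorem two_mul_chainSide_succ_le (m : ℕ) :
    2 * chainSide (m + 1) ≤ Real.exp ((-2) ^ m + 24 * 2 ^ m) := by
  have h1 : (1 : ℝ) ≤ 2 ^ m := one_le_pow₀ one_le_two
  have h2 := abs_le.1 (abs_neg_two_pow m).le
  have h3 : 2 ≤ Real.exp (2 ^ m) := by linarith [Real.add_one_le_exp (2 ^ m : ℝ)]
  rw [chainSide_eq]
  calc 2 * Real.exp ((-2) ^ (m + 1) + 6 * 2 ^ (m + 1))
      ≤ Real.exp (2 ^ m) * Real.exp ((-2) ^ (m + 1) + 6 * 2 ^ (m + 1)) := by gcongr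
    _ ≤ _ := by
      rw [← Real.exp_add]
      refine Real.exp_le_exp.2 ?_
      rw [pow_succ, pow_succ]
      linarith [h2.1, h2.2]

theorem exists_scale (m : ℕ) : ∃ k : ℤ, chainSide m ≤ (2 : ℝ) ^ k ∧ (2 : ℝ) ^ k < 2 * chainSide m := by
  obtain ⟨k, h1, h2⟩ := exists_mem_Ioc_zpow (y := (2 : ℝ)) (x := chainSide m)
    (minSide_pos (by positivity)) one_lt_two
  refine ⟨k + 1, h2, ?_⟩
  rw [zpow_add_one₀ two_ne_zero]
  linarith

/-- The scale of the smallest admissible cubes for the `m`-th interval of the chain. -/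
def chainScale (m : ℕ) : ℤ := (exists_scale m).choose

theorem chainSide_le (m : ℕ) : chainSide m ≤ (2 : ℝ) ^ chainScale m :=
  (exists_scale m).choose_spec.1

theorem lt_chainSide (m : ℕ) : (2 : ℝ) ^ chainScale m < 2 * chainSide m :=
  (exists_scale m).choose_spec.2

theorem chainScale_le_succ (m : ℕ) : chainScale m ≤ chainScale (m + 1) := by
  rw [← zpow_le_zpow_iff_right₀ (one_lt_two (α := ℝ))]
  exact (lt_chainSide m).le.trans ((two_mul_chainSide_le m).trans (chainSide_le _))

/-- The parameters of the chain: the cubes are enlarged until the interval can be doubled. -/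
def chainIndex : ℕ → ℕ × ℤ
  | 0 => (0, chainScale 0)
  | j + 1 =>
    if (chainIndex j).2 < chainScale ((chainIndex j).1 + 1) then
      ((chainIndex j).1, (chainIndex j).2 + 1)
    else ((chainIndex j).1 + 1, (chainIndex j).2)

theorem chainIndex_bounds (j : ℕ) : chainScale (chainIndex j).1 ≤ (chainIndex j).2 ∧
    (chainIndex j).2 ≤ chainScale ((chainIndex j).1 + 1) := by
  induction j with
  | zero => exact ⟨le_rfl, chainScale_le_succ 0⟩
  | succ j ih =>
    rw [chainIndex]
    split_ifs with h
    · exact ⟨by simp only; lia, by simp only; lia⟩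
    · exact ⟨not_lt.1 h, ih.2.trans (chainScale_le_succ _)⟩

/-- The tile on the `m`-th interval with cubes of scale `k`. -/
def chainTile (a : ℕ × ℤ) : Tile := ⟨(-2) ^ a.1, 3 * 2 ^ a.1, a.2⟩

theorem isAdmissible_chainTile (j : ℕ) : (chainTile (chainIndex j)).IsAdmissible := by
  obtain ⟨h1, h2⟩ := chainIndex_bounds j
  set m := (chainIndex j).1
  set k := (chainIndex j).2
  have hm : (1 : ℝ) ≤ 2 ^ m := one_le_pow₀ one_le_two
  refine ⟨by simp only [chainTile]; positivity, fun h => ?_, fun h => ⟨?_, ?_⟩⟩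
  · simp only [chainTile] at h
    linarith
  · have h3 := (chainSide_le m).trans (zpow_le_zpow_right₀ (one_le_two (α := ℝ)) h1)
    rwa [chainSide, minSide_of_one_le (by linarith), Real.exp_add] at h3
  · have h3 := ((zpow_le_zpow_right₀ (one_le_two (α := ℝ)) h2).trans_lt (lt_chainSide _)).trans_le
      (two_mul_chainSide_succ_le m)
    rw [← Real.exp_add]
    simp only [chainTile]
    rwa [← mul_assoc, show (8 : ℝ) * 3 = 24 by norm_num]

/-- The `m`-th interval is `[-2·2^m, 4·2^m)` for even `m` and `[-4·2^m, 2·2^m)` for odd `m`. So it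
is the right, respectively left, half of its successor; alternating sides makes the union all of
`ℝ`. -/
theorem chainTile_mem_children (j : ℕ) :
    chainTile (chainIndex j) ∈ (chainTile (chainIndex (j + 1))).children := by
  obtain ⟨h1, h2⟩ := chainIndex_bounds j
  rw [chainIndex]
  split_ifs with h
  · rw [Tile.children, if_neg]
    · simp [chainTile, Tile.refine]
    · rw [Tile.IsShort, not_lt]
      have h3 := (chainSide_le _).trans (zpow_le_zpow_right₀ (one_le_two (α := ℝ)) h1)
      rw [chainSide] at h3
      simp only [chainTile]
      rw [zpow_add_one₀ two_ne_zero]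
      linarith
  · have he := h2.antisymm (not_lt.1 h)
    rw [Tile.children, if_pos]
    · simp only [chainTile, Tile.left, Tile.right, Set.mem_insert_iff, Set.mem_singleton_iff,
        Tile.mk.injEq, and_true]
      rcases Nat.even_or_odd (chainIndex j).1 with hp | hp
      · right
        rw [pow_succ, pow_succ, hp.neg_pow]
        constructor <;> ring
      · left
        rw [pow_succ, pow_succ, hp.neg_pow]
        constructor <;> ring
    · have h3 := lt_chainSide ((chainIndex j).1 + 1)
      rw [Tile.IsShort]
      simp only [chainTile]
      rwa [he]

theorem exists_chainIndex_fst_eq (M : ℕ) : ∃ j, (chainIndex j).1 = M := by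
  induction M with
  | zero => exact ⟨0, rfl⟩
  | succ M ih =>
    -- Here `d` counts the enlargements of the cubes that remain before the interval is doubled.
    suffices ∀ d : ℕ, ∀ j, (chainIndex j).1 = M → (chainIndex j).2 + d = chainScale (M + 1) →
        ∃ j, (chainIndex j).1 = M + 1 by
      obtain ⟨j, hj⟩ := ih
      have h := (chainIndex_bounds j).2
      rw [hj] at h
      exact this (chainScale (M + 1) - (chainIndex j).2).toNat j hj (by lia)
    intro d
    induction d with
    | zero =>
      intro j hj hd
      refine ⟨j + 1, ?_⟩
      rw [chainIndex, if_neg]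
      · simp only [hj]
      · rw [hj]; push_cast at hd; lia
    | succ d ihd =>
      intro j hj hd
      push_cast at hd
      have hlt : (chainIndex j).2 < chainScale ((chainIndex j).1 + 1) := by rw [hj]; lia
      refine ihd (j + 1) ?_ ?_
      · rw [chainIndex, if_pos hlt, hj]
      · rw [chainIndex, if_pos hlt]
        simp only
        lia

theorem chainTile_interval_mono {i j : ℕ} (hij : i ≤ j) :
    (chainTile (chainIndex i)).interval ⊆ (chainTile (chainIndex j)).interval := by
  refine monotone_nat_of_le_succ (f := fun j => (chainTile (chainIndex j)).interval) (fun j => ?_) hij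
  rw [← Tile.biUnion_children (isAdmissible_chainTile (j + 1)).1]
  exact Set.subset_biUnion_of_mem (u := Tile.interval) (chainTile_mem_children j)

theorem exists_mem_chainTile_interval (y : ℝ) : ∃ j, y ∈ (chainTile (chainIndex j)).interval := by
  obtain ⟨M, hM⟩ := pow_unbounded_of_one_lt |y| (one_lt_two (α := ℝ))
  obtain ⟨j, hj⟩ := exists_chainIndex_fst_eq M
  refine ⟨j, ?_⟩
  have h2 := abs_le.1 (abs_neg_two_pow M).le
  have h3 := abs_lt.1 hM
  simp only [Tile.interval, chainTile, hj, Set.mem_Ico]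
  constructor <;> linarith [h2.1, h2.2, h3.1, h3.2]

/-- The tiles of generation `j`. -/
def tiles (j : ℤ) : Set Tile :=
  {T | ∃ J i : ℕ, (J : ℤ) - i = j ∧ T ∈ Tile.descendants i (chainTile (chainIndex J))}

/-- Starting the subdivision higher in the chain reproduces the earlier tiles, because each chain
tile is a child of the next. Hence any two tiles of one generation descend from a common chain tile
in equally many steps. -/
theorem descendants_chainTile_subset (J i d : ℕ) :
    Tile.descendants i (chainTile (chainIndex J)) ⊆
      Tile.descendants (i + d) (chainTile (chainIndex (J + d))) := by
  have hone : ∀ J i : ℕ, Tile.descendants i (chainTile (chainIndex J)) ⊆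
      Tile.descendants (i + 1) (chainTile (chainIndex (J + 1))) := by
    intro J i
    induction i with
    | zero =>
      rintro T rfl
      simpa [Tile.descendants] using chainTile_mem_children J
    | succ i ih =>
      rw [Tile.descendants, Tile.descendants.eq_2 _ (i + 1)]
      exact Set.biUnion_subset_biUnion_left ih
  induction d with
  | zero => exact subset_rfl
  | succ d ih => exact ih.trans (hone _ _)

theorem IsAdmissible.of_mem_tiles {j : ℤ} {T : Tile} (hT : T ∈ tiles j) : T.IsAdmissible := by
  obtain ⟨J, i, -, hT⟩ := hT
  exact (isAdmissible_chainTile J).of_mem_descendants hT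

theorem pairwiseDisjoint_tiles (j : ℤ) : (tiles j).PairwiseDisjoint Tile.interval := by
  suffices ∀ J i J' i' : ℕ, (J : ℤ) - i = j → (J' : ℤ) - i' = j → J ≤ J' →
      ∀ A ∈ Tile.descendants i (chainTile (chainIndex J)),
      ∀ B ∈ Tile.descendants i' (chainTile (chainIndex J')), A ≠ B →
      Disjoint A.interval B.interval by
    rintro A ⟨J, i, hJ, hA⟩ B ⟨J', i', hJ', hB⟩ hne
    rcases le_total J J' with h | h
    · exact this J i J' i' hJ hJ' h A hA B hB hne
    · exact (this J' i' J i hJ' hJ h B hB A hA hne.symm).symm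
  intro J i J' i' hJ hJ' hle A hA B hB hne
  obtain ⟨d, rfl⟩ := Nat.exists_eq_add_of_le hle
  obtain rfl : i' = i + d := by push_cast at hJ'; lia
  exact Tile.pairwiseDisjoint_descendants (isAdmissible_chainTile _) _
    (descendants_chainTile_subset J i d hA) hB hne

theorem exists_mem_tiles (j : ℤ) (y : ℝ) : ∃ T ∈ tiles j, y ∈ T.interval := by
  obtain ⟨J, hJ⟩ := exists_mem_chainTile_interval y
  -- The maximum ensures that the chain tile is of generation at least `j`, so that generation `j`
  -- is reached by subdivision.
  have h := chainTile_interval_mono (le_max_left J j.toNat) hJ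
  rw [← Tile.biUnion_descendants (isAdmissible_chainTile _)
    ((max J j.toNat : ℕ) - j).toNat] at h
  obtain ⟨T, hT, hy⟩ := Set.mem_iUnion₂.1 h
  exact ⟨T, ⟨max J j.toNat, _, by lia, hT⟩, hy⟩

theorem children_subset_tiles {j : ℤ} {T : Tile} (hT : T ∈ tiles j) :
    T.children ⊆ tiles (j - 1) := by
  obtain ⟨J, i, hJ, hT⟩ := hT
  exact fun T' hT' => ⟨J, i + 1, by push_cast; lia, Set.mem_biUnion hT hT'⟩

theorem exists_parent_mem_tiles {j : ℤ} {T : Tile} (hT : T ∈ tiles j) :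
    ∃ T' ∈ tiles (j + 1), T ∈ T'.children := by
  obtain ⟨J, i, hJ, hT⟩ := hT
  cases i with
  | zero =>
    obtain rfl : T = _ := hT
    exact ⟨_, ⟨J + 1, 0, by push_cast at hJ ⊢; lia, rfl⟩, chainTile_mem_children J⟩
  | succ i =>
    obtain ⟨T', hT', h⟩ := Set.mem_iUnion₂.1 hT
    exact ⟨T', ⟨J, i, by push_cast at hJ ⊢; lia, hT'⟩, h⟩

/-! ### Existence of dyadic grids -/

theorem mem_dyadicCube_iff {k : ℤ} {m : Fin n → ℤ} {x : Fin n → ℝ} :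
    x ∈ dyadicCube k m ↔ ∀ i, ⌊x i / (2 : ℝ) ^ k⌋ = m i := by
  have h := zpow_pos (two_pos : (0 : ℝ) < 2) k
  refine forall_congr' fun i => ?_
  rw [Int.floor_eq_iff, le_div_iff₀ h, div_lt_iff₀ h, mul_comm (m i : ℝ), mul_comm ((m i : ℝ) + 1)]

theorem dyadicCube_nonempty (k : ℤ) (m : Fin n → ℤ) : (dyadicCube k m).Nonempty := by
  refine ⟨fun i => (2 : ℝ) ^ k * m i, mem_dyadicCube_iff.2 fun i => ?_⟩
  rw [mul_div_cancel_left₀ _ (zpow_pos (two_pos : (0 : ℝ) < 2) k).ne', Int.floor_intCast]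

theorem dyadicCube_injective (k : ℤ) : Function.Injective (dyadicCube (n := n) k) := by
  intro m m' h
  obtain ⟨x, hx⟩ := dyadicCube_nonempty k m
  have hx' := h ▸ hx
  funext i
  rw [← mem_dyadicCube_iff.1 hx i, ← mem_dyadicCube_iff.1 hx' i]

theorem disjoint_dyadicCube (k : ℤ) {m m' : Fin n → ℤ} (h : m ≠ m') :
    Disjoint (dyadicCube k m) (dyadicCube k m') := by
  refine Set.disjoint_left.2 fun x hx hx' => h ?_
  funext i
  rw [← mem_dyadicCube_iff.1 hx i, ← mem_dyadicCube_iff.1 hx' i]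

theorem floor_div_zpow_sub_one (y : ℝ) (k : ℤ) :
    ⌊y / (2 : ℝ) ^ k⌋ = ⌊y / (2 : ℝ) ^ (k - 1)⌋ / 2 := by
  have h : y / (2 : ℝ) ^ k = y / (2 : ℝ) ^ (k - 1) / (2 : ℕ) := by
    rw [zpow_sub_one₀ two_ne_zero]
    push_cast
    field_simp
  rw [h, Int.floor_div_natCast]
  rfl

/-- The index of a subcube of a dyadic cube. -/
def subIndex (m : Fin n → ℤ) (v : Fin n → Fin 2) (i : Fin n) : ℤ := 2 * m i + (v i : ℕ)

theorem subIndex_injective (m : Fin n → ℤ) : Function.Injective (subIndex m) := by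
  intro v w h
  funext i
  have := congrFun h i
  simp only [subIndex] at this
  exact Fin.ext (by lia)

theorem iUnion_dyadicCube_subIndex (k : ℤ) (m : Fin n → ℤ) :
    ⋃ v, dyadicCube (k - 1) (subIndex m v) = dyadicCube k m := by
  ext x
  simp only [Set.mem_iUnion, mem_dyadicCube_iff, floor_div_zpow_sub_one _ k]
  constructor
  · rintro ⟨v, hv⟩ i
    have := (v i).isLt
    rw [hv i, subIndex]
    lia
  · intro h
    refine ⟨fun i => ⟨(⌊x i / (2 : ℝ) ^ (k - 1)⌋ % 2).toNat, by lia⟩, fun i => ?_⟩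
    rw [subIndex, ← h i]
    simp only
    lia

theorem exists_dyadicCube_superset (k : ℤ) (m : Fin n → ℤ) :
    ∃ m' : Fin n → ℤ, dyadicCube (k - 1) m ⊆ dyadicCube k m' := by
  refine ⟨fun i => m i / 2, fun x hx => mem_dyadicCube_iff.2 fun i => ?_⟩
  rw [floor_div_zpow_sub_one, mem_dyadicCube_iff.1 hx i]

namespace Tile

/-- The product of a dyadic cube and the interval of a tile. -/
def box (T : Tile) (m : Fin n → ℤ) : Set (S n) := dyadicCube T.k m ×ˢ T.interval

theorem measure_box (T : Tile) (m : Fin n → ℤ) :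
    rho n (T.box m) = ENNReal.ofReal ((2 : ℝ) ^ T.k) ^ n * ENNReal.ofReal (2 * T.r) := by
  rw [box, interval, volume_cube_prod_Ico]
  ring_nf

theorem measure_box_eq_two_pow_mul (T : Tile) (m m' : Fin n → ℤ) :
    rho n (T.box m) = 2 ^ n * rho n (T.refine.box m') := by
  rw [measure_box, measure_box, ← mul_assoc, ← mul_pow]
  congr 2
  simp only [refine]
  rw [zpow_sub_one₀ two_ne_zero, ENNReal.ofReal_mul (by positivity), mul_comm, mul_assoc,
    ← ENNReal.ofReal_ofNat, ← ENNReal.ofReal_mul (by norm_num)]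
  norm_num

theorem measure_box_eq_two_mul (T : Tile) (m m' : Fin n → ℤ) (t : ℝ) :
    rho n (T.box m) = 2 * rho n (Tile.box ⟨t, T.r / 2, T.k⟩ m') := by
  rw [measure_box, measure_box, mul_left_comm]
  congr 1
  rw [← ENNReal.ofReal_ofNat, ← ENNReal.ofReal_mul (by norm_num)]
  congr 1
  ring

end Tile

/-- The sets of generation `j` of the dyadic grid. -/
def grid (n : ℕ) (j : ℤ) : Set (Set (S n)) := {R | ∃ T ∈ tiles j, ∃ m, R = T.box m}

theorem eq_of_mem_grid {j : ℤ} {R R' : Set (S n)} (hR : R ∈ grid n j) (hR' : R' ∈ grid n j)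
    {x : S n} (hx : x ∈ R) (hx' : x ∈ R') : R = R' := by
  obtain ⟨T, hT, m, rfl⟩ := hR
  obtain ⟨T', hT', m', rfl⟩ := hR'
  obtain rfl : T = T' := by
    by_contra hne
    exact Set.disjoint_left.1 (pairwiseDisjoint_tiles j hT hT' hne) hx.2 hx'.2
  obtain rfl : m = m' := by
    by_contra hne
    exact Set.disjoint_left.1 (disjoint_dyadicCube _ hne) hx.1 hx'.1
  rfl

theorem two_le_two_pow (hn : 1 ≤ n) : (2 : ℝ≥0∞) ≤ 2 ^ n :=
  le_self_pow₀ one_le_two (by lia)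

/-- Used with `c = 2` when the interval is halved and `c = 2^n` when the cubes are. -/
theorem measure_bounds_of_eq_mul {R R' : Set (S n)} {c : ℝ≥0∞} (h : rho n R = c * rho n R')
    (h2 : 2 ≤ c) (hc : c ≤ ratio n) :
    rho n R / ratio n ≤ rho n R' ∧ rho n R' ≤ 2 / 3 * rho n R := by
  constructor
  · refine ENNReal.div_le_of_le_mul ?_
    rw [h, mul_comm (rho n R')]
    gcongr
  · rw [h, ← mul_assoc]
    refine le_mul_of_one_le_left' ?_
    calc (1 : ℝ≥0∞) ≤ 2 / 3 * 2 := by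
          rw [mul_comm, ← mul_div_assoc, ENNReal.le_div_iff_mul_le (by simp) (by simp)]
          norm_num
      _ ≤ 2 / 3 * c := by gcongr

theorem two_le_ratio : 2 ≤ ratio n := le_max_of_le_left (by norm_num)

theorem exists_children_of_mem_grid (hn : 1 ≤ n) {j : ℤ} {R : Set (S n)} (hR : R ∈ grid n j) :
    ∃ F : Finset (Set (S n)),
      (F.card = 2 ∨ F.card = 2 ^ n) ∧ (F : Set (Set (S n))) ⊆ grid n (j - 1) ∧
      (F : Set (Set (S n))).PairwiseDisjoint id ∧ R = ⋃₀ (F : Set (Set (S n))) ∧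
      ∀ R' ∈ F, rho n R / ratio n ≤ rho n R' ∧ rho n R' ≤ 2 / 3 * rho n R := by
  classical
  obtain ⟨T, hT, m, rfl⟩ := hR
  have hr : 0 < T.r := (IsAdmissible.of_mem_tiles hT).1
  have hch := children_subset_tiles hT
  rw [Tile.children] at hch
  split_ifs at hch with hs
  · have hdisj : Disjoint (T.left.box m) (T.right.box m) :=
      Set.Disjoint.set_prod_right T.disjoint_interval_left_right _ _
    have hne : T.left.box m ≠ T.right.box m := by
      intro h
      rw [h, disjoint_self, Set.bot_eq_empty] at hdisj
      have := ((dyadicCube_nonempty T.k m).prod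
        (Set.nonempty_Ico.2 (by simp only [Tile.right]; linarith) :
          (T.right.interval).Nonempty)).ne_empty
      exact this hdisj
    refine ⟨{T.left.box m, T.right.box m}, .inl (Finset.card_pair hne), ?_, ?_, ?_, ?_⟩
    · rw [Finset.coe_pair]
      rintro _ (rfl | rfl)
      · exact ⟨_, hch (by simp), m, rfl⟩
      · exact ⟨_, hch (by simp), m, rfl⟩
    · rw [Finset.coe_pair]
      rintro A (rfl | rfl) B (rfl | rfl) hAB
      · exact absurd rfl hAB
      · exact hdisj
      · exact hdisj.symm
      · exact absurd rfl hAB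
    · rw [Finset.coe_pair, Set.sUnion_pair, Tile.box, ← Tile.interval_left_union_right hr,
        Set.prod_union]
      rfl
    · intro R' hR'
      rw [Finset.mem_insert, Finset.mem_singleton] at hR'
      rcases hR' with rfl | rfl
      · exact measure_bounds_of_eq_mul (T.measure_box_eq_two_mul m m _) le_rfl two_le_ratio
      · exact measure_bounds_of_eq_mul (T.measure_box_eq_two_mul m m _) le_rfl two_le_ratio
  · have hinj : Function.Injective fun v => T.refine.box (subIndex m v) := by
      intro v w h
      have hne : (T.refine.interval).Nonempty :=
        Set.nonempty_Ico.2 (by simp only [Tile.refine]; linarith)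
      have h' : dyadicCube T.refine.k (subIndex m v) = dyadicCube T.refine.k (subIndex m w) := by
        have := congrArg (Set.image Prod.fst) h
        simpa only [Tile.box, Set.fst_image_prod _ hne] using this
      exact subIndex_injective m (dyadicCube_injective _ h')
    refine ⟨Finset.univ.image fun v => T.refine.box (subIndex m v), .inr ?_, ?_, ?_, ?_, ?_⟩
    · rw [Finset.card_image_of_injective _ hinj]
      simp
    · rw [Finset.coe_image]
      rintro _ ⟨v, -, rfl⟩
      exact ⟨_, hch rfl, _, rfl⟩
    · rw [Finset.coe_image]
      rintro _ ⟨v, -, rfl⟩ _ ⟨w, -, rfl⟩ hne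
      exact Set.Disjoint.set_prod_left
        (disjoint_dyadicCube _ fun h => hne (by simp only [h])) _ _
    · rw [Finset.coe_image, Set.sUnion_image]
      simp only [Finset.coe_univ, Set.mem_univ, Set.iUnion_true]
      rw [Tile.box, ← iUnion_dyadicCube_subIndex, Set.iUnion_prod_const]
      rfl
    · intro R' hR'
      obtain ⟨v, -, rfl⟩ := Finset.mem_image.1 hR'
      exact measure_bounds_of_eq_mul (T.measure_box_eq_two_pow_mul m _) (two_le_two_pow hn)
        (le_max_right _ _)

theorem exists_parent_of_mem_grid {j : ℤ} {R : Set (S n)} (hR : R ∈ grid n j) :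
    ∃ R' ∈ grid n (j + 1), R ⊆ R' ∧ rho n R' ≤ ratio n * rho n R := by
  obtain ⟨T, hT, m, rfl⟩ := hR
  obtain ⟨T', hT', hmem⟩ := exists_parent_mem_tiles hT
  have hsub : T.interval ⊆ T'.interval := by
    rw [← Tile.biUnion_children (IsAdmissible.of_mem_tiles hT').1]
    exact Set.subset_biUnion_of_mem (u := Tile.interval) hmem
  rw [Tile.children] at hmem
  split_ifs at hmem with hs
  · refine ⟨T'.box m, ⟨T', hT', m, rfl⟩, ?_, ?_⟩
    · refine Set.prod_mono ?_ hsub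
      rcases hmem with rfl | rfl <;> exact subset_rfl
    · have : rho n (T'.box m) = 2 * rho n (T.box m) := by
        rcases hmem with rfl | rfl <;> exact T'.measure_box_eq_two_mul m m _
      rw [this]
      gcongr
      exact two_le_ratio
  · obtain rfl : T = T'.refine := hmem
    obtain ⟨m', hm'⟩ := exists_dyadicCube_superset T'.k m
    refine ⟨T'.box m', ⟨T', hT', m', rfl⟩, Set.prod_mono hm' hsub, ?_⟩
    rw [T'.measure_box_eq_two_pow_mul m' m]
    gcongr
    exact le_max_right _ _

theorem nonempty_of_mem_grid {j : ℤ} {R : Set (S n)} (hR : R ∈ grid n j) : R.Nonempty := by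
  obtain ⟨T, hT, m, rfl⟩ := hR
  have := (IsAdmissible.of_mem_tiles hT).1
  exact (dyadicCube_nonempty _ m).prod (Set.nonempty_Ico.2 (by linarith))

theorem isCZSet_of_mem_grid {j : ℤ} {R : Set (S n)} (hR : R ∈ grid n j) : IsCZSet R := by
  obtain ⟨T, hT, m, rfl⟩ := hR
  have := IsAdmissible.of_mem_tiles hT
  exact ⟨T.k, m, T.t, T.r, this.1, this.2, rfl⟩

theorem exists_ancestor_of_mem_grid {l : ℤ} {R : Set (S n)} (hR : R ∈ grid n l) (d : ℕ) :
    ∃ R' ∈ grid n (l + d), R ⊆ R' := by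
  induction d with
  | zero => exact ⟨R, by simpa using hR, subset_rfl⟩
  | succ d ih =>
    obtain ⟨A, hA, hRA⟩ := ih
    obtain ⟨B, hB, hAB, -⟩ := exists_parent_of_mem_grid hA
    exact ⟨B, by rwa [Nat.cast_succ, ← add_assoc], hRA.trans hAB⟩

/-- A sequence in which each term is at most two thirds of the next one tends to `0` and `∞`. -/
theorem tendsto_of_le_two_thirds_mul {u : ℤ → ℝ≥0∞} (h : ∀ j, u j ≤ 2 / 3 * u (j + 1))
    (h0 : u 0 ≠ 0) (h0' : u 0 ≠ ∞) : Tendsto u atBot (𝓝 0) ∧ Tendsto u atTop (𝓝 ∞) := by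
  have hlt : (2 / 3 : ℝ≥0∞) < 1 := by
    rw [ENNReal.div_lt_iff (by simp) (by simp)]; norm_num
  have hmono : Monotone u := monotone_int_of_le_succ fun j =>
    (h j).trans (mul_le_of_le_one_left' hlt.le)
  have hpow : ∀ (j : ℤ) (i : ℕ), u j ≤ (2 / 3) ^ i * u (j + i) := by
    intro j i
    induction i with
    | zero => simp
    | succ i ih =>
      refine ih.trans ?_
      rw [pow_succ, mul_assoc, Nat.cast_succ, ← add_assoc]
      gcongr
      exact h _
  have hzero : ∀ c : ℝ≥0∞, c ≠ ∞ → Tendsto (fun i : ℕ => (2 / 3 : ℝ≥0∞) ^ i * c) atTop (𝓝 0) := by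
    intro c hc
    have := ENNReal.Tendsto.mul_const (b := c)
      (ENNReal.tendsto_pow_atTop_nhds_zero_of_lt_one hlt) (.inr hc)
    rwa [zero_mul] at this
  constructor
  · have hinf : ⨅ j, u j = 0 := by
      refine le_antisymm (ge_of_tendsto' (hzero (u 0) h0') fun i => ?_) bot_le
      have := hpow (-i) i
      rw [neg_add_cancel] at this
      exact (iInf_le _ _).trans this
    rw [← hinf]
    exact tendsto_atBot_iInf hmono
  · have hsup : ⨆ j, u j = ∞ := by
      by_contra hne
      refine h0 (le_antisymm (ge_of_tendsto' (hzero _ hne) fun i => ?_) bot_le)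
      exact (hpow 0 i).trans (mul_le_mul' le_rfl (le_iSup u _))
    rw [← hsup]
    exact tendsto_atTop_iSup hmono

theorem isDyadicGrid_grid (hn : 1 ≤ n) : IsDyadicGrid (grid n) where
  isCZSet _ _ := isCZSet_of_mem_grid
  pairwiseDisjoint j A hA B hB hne :=
    Set.disjoint_left.2 fun _ hx hx' => hne (eq_of_mem_grid hA hB hx hx')
  sUnion_eq j := by
    refine Set.eq_univ_of_forall fun x => ?_
    obtain ⟨T, hT, hx⟩ := exists_mem_tiles j x.2
    exact ⟨T.box fun i => ⌊x.1 i / (2 : ℝ) ^ T.k⌋, ⟨T, hT, _, rfl⟩,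
      mem_dyadicCube_iff.2 fun _ => rfl, hx⟩
  nested l k hlk R hR R' hR' := by
    obtain ⟨d, rfl⟩ := Int.le.dest hlk
    obtain ⟨A, hA, hRA⟩ := exists_ancestor_of_mem_grid hR d
    refine or_iff_not_imp_right.2 fun h => ?_
    obtain ⟨x, hx, hx'⟩ := Set.nonempty_iff_ne_empty.2 h
    rwa [eq_of_mem_grid hR' hA hx' (hRA hx)]
  parent j R hR := by
    obtain ⟨R', hR', hsub, hle⟩ := exists_parent_of_mem_grid hR
    refine ⟨R', ⟨hR', hsub, hle⟩, fun A hA => ?_⟩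
    obtain ⟨x, hx⟩ := nonempty_of_mem_grid hR
    exact eq_of_mem_grid hA.1 hR' (hA.2.1 hx) (hsub hx)
  children _ _ := exists_children_of_mem_grid hn
  tendsto_measure x R hR := by
    have hcz := isCZSet_of_mem_grid (hR 0).1
    refine tendsto_of_le_two_thirds_mul (fun j => ?_) hcz.measure_pos.ne' hcz.measure_ne_top
    obtain ⟨F, -, hF, -, hU, hle⟩ := exists_children_of_mem_grid hn (hR (j + 1)).1
    have hx := (hR (j + 1)).2
    rw [hU] at hx
    obtain ⟨A, hA, hxA⟩ := hx
    have hA' : A ∈ grid n j := by simpa using hF hA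
    rw [← eq_of_mem_grid hA' (hR j).1 hxA (hR j).2]
    exact (hle A hA).2

/-! ### The inequalities for the full sharp function -/

theorem eLpNorm_dyadicSharp_le {D : ℤ → Set (Set (S n))} (hD : IsDyadicGrid D) (f : S n → ℂ)
    (p : ℝ≥0∞) : eLpNorm (dyadicSharp D f) p (rho n) ≤ eLpNorm (sharp f) p (rho n) :=
  eLpNorm_mono_enorm fun x => by simpa using hD.dyadicSharp_le_sharp f x

/-- The sharp maximal inequalities with a constant that depends only on `n` and `p`. -/
theorem exists_sharp_const (hn : 1 ≤ n) {p : ℝ≥0∞} (hp : 0 < p) (hp' : p < ∞) :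
    ∃ A : ℝ≥0, 0 < A ∧
      (∀ D : ℤ → Set (Set (S n)), IsDyadicGrid D → ∀ f : S n → ℂ, LocallyIntegrable f (rho n) →
        ∀ p₀ : ℝ≥0∞, 0 < p₀ → p₀ ≤ p → MemLp (dyadicSharp D f) p (rho n) →
          MemLp (dyadicMaximal D f) p₀ (rho n) →
          MemLp f p (rho n) ∧
          eLpNorm (dyadicMaximal D f) p (rho n) ≤ A * eLpNorm (dyadicSharp D f) p (rho n) ∧
          eLpNorm f p (rho n) ≤ A * eLpNorm (sharp f) p (rho n)) ∧
      (∀ f : S n → ℂ, LocallyIntegrable f (rho n) →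
        ∀ p₀ : ℝ≥0∞, 0 < p₀ → p₀ ≤ p → MemLp (sharp f) p (rho n) → MemLp f p₀ (rho n) →
          MemLp f p (rho n) ∧ eLpNorm f p (rho n) ≤ A * eLpNorm (sharp f) p (rho n)) := by
  set C : ℝ≥0∞ := globalConst n p.toReal ^ (p.toReal)⁻¹ with hC
  have hCtop : C ≠ ∞ := ENNReal.rpow_ne_top_of_nonneg (by positivity)
    (globalConst_ne_top n (ENNReal.toReal_pos hp.ne' hp'.ne))
  have hCle : C ≤ ((max 1 C.toNNReal : ℝ≥0) : ℝ≥0∞) := by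
    rw [← ENNReal.coe_toNNReal hCtop]
    exact_mod_cast le_max_right _ _
  have main : ∀ D : ℤ → Set (Set (S n)), IsDyadicGrid D → ∀ f : S n → ℂ,
      LocallyIntegrable f (rho n) → ∀ p₀ : ℝ≥0∞, 0 < p₀ → p₀ ≤ p → MemLp f p₀ (rho n) →
      eLpNorm (dyadicSharp D f) p (rho n) < ∞ → MemLp f p (rho n) ∧
      eLpNorm (dyadicMaximal D f) p (rho n) ≤
        (max 1 C.toNNReal : ℝ≥0) * eLpNorm (dyadicSharp D f) p (rho n) ∧
      eLpNorm f p (rho n) ≤ (max 1 C.toNNReal : ℝ≥0) * eLpNorm (sharp f) p (rho n) := by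
    intro D hD f hf p₀ hp₀ hp₀p hfp hs
    have hM := (hD.eLpNorm_dyadicMaximal_le hf hp.ne' hp'.ne hp₀.ne' (hp₀p.trans_lt hp').ne
      hfp hs).trans (mul_le_mul' hCle le_rfl)
    refine ⟨hD.memLp_of_dyadicMaximal hf
      (hM.trans_lt (ENNReal.mul_lt_top ENNReal.coe_lt_top hs)), hM, ?_⟩
    calc eLpNorm f p (rho n) ≤ eLpNorm (dyadicMaximal D f) p (rho n) :=
          eLpNorm_mono_enorm_ae (by simpa using hD.ae_enorm_le_dyadicMaximal hf)
      _ ≤ _ := hM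
      _ ≤ _ := mul_le_mul' le_rfl (eLpNorm_dyadicSharp_le hD f p)
  -- The maximum with `1` only serves to make the constant positive.
  refine ⟨max 1 C.toNNReal, lt_max_of_lt_left one_pos, ?_, ?_⟩
  · intro D hD f hf p₀ hp₀ hp₀p hs hM
    exact main D hD f hf p₀ hp₀ hp₀p (hD.memLp_of_dyadicMaximal hf hM.2) hs.2
  · intro f hf p₀ hp₀ hp₀p hs hfp
    obtain ⟨h1, -, h3⟩ := main _ (isDyadicGrid_grid hn) f hf p₀ hp₀ hp₀p hfp
      ((eLpNorm_dyadicSharp_le (isDyadicGrid_grid hn) f p).trans_lt hs.2)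
    exact ⟨h1, h3⟩

end AxPlusB
end

theorem corollary4p1 (n : ℕ) (hn : 1 ≤ n) :
    (∃ D : ℤ → Set (Set (AxPlusB.S n)), AxPlusB.IsDyadicGrid D) ∧
    ∀ p : ℝ≥0∞, 0 < p → p < ∞ → ∃ A : ℝ≥0, 0 < A ∧
      (∀ D : ℤ → Set (Set (AxPlusB.S n)), AxPlusB.IsDyadicGrid D →
        ∀ f : AxPlusB.S n → ℂ, LocallyIntegrable f (AxPlusB.rho n) →
        ∀ p₀ : ℝ≥0∞, 0 < p₀ → p₀ ≤ p →
          MemLp (AxPlusB.dyadicSharp D f) p (AxPlusB.rho n) →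
          MemLp (AxPlusB.dyadicMaximal D f) p₀ (AxPlusB.rho n) →
          MemLp f p (AxPlusB.rho n) ∧
          eLpNorm (AxPlusB.dyadicMaximal D f) p (AxPlusB.rho n) ≤
            A * eLpNorm (AxPlusB.dyadicSharp D f) p (AxPlusB.rho n) ∧
          eLpNorm f p (AxPlusB.rho n) ≤
            A * eLpNorm (AxPlusB.sharp f) p (AxPlusB.rho n)) ∧
      (∀ f : AxPlusB.S n → ℂ, LocallyIntegrable f (AxPlusB.rho n) →
        ∀ p₀ : ℝ≥0∞, 0 < p₀ → p₀ ≤ p →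
          MemLp (AxPlusB.sharp f) p (AxPlusB.rho n) →
          MemLp f p₀ (AxPlusB.rho n) →
          MemLp f p (AxPlusB.rho n) ∧
          eLpNorm f p (AxPlusB.rho n) ≤
            A * eLpNorm (AxPlusB.sharp f) p (AxPlusB.rho n)) := by
  exact ⟨⟨_, AxPlusB.isDyadicGrid_grid hn⟩, fun _ => AxPlusB.exists_sharp_const hn⟩
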